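/- **2P Ewald sum.** Let $L>0$, let $q_1,\dots,q_N\in\mathbb{R}$ be charges with $\sum_{n=1}^N q_n=0$, located at points $\mathbf{x}_n=(\mathbf{r}_n,z_n)\in\mathbb{R}^2\times\mathbb{R}$ that are pairwise distinct modulo the translations $\tilde{\mathbf{p}}=L(p_1,p_2,0)$, $\mathbf{p}\in\mathbb{Z}^2$. Write $\mathrm{erf}(t)=\frac{2}{\sqrt\pi}\int_0^t e^{-s^2}\,ds$ and $\mathrm{erfc}(t)=\frac{2}{\sqrt\pi}\int_t^\infty e^{-s^2}\,ds$. Consider the Poisson problem with two periodic directions and one free direction $$-\Delta\phi(\mathbf{x})=4\pi\sum_{n=1}^N\sum_{\mathbf{p}\in\mathbb{Z}^2}q_n\,\delta(\mathbf{x}-\mathbf{x}_n+\tilde{\mathbf{p}}),\qquad \lim_{z\to\pm\infty}\phi(\mathbf{r},z)=\pm\frac{2\pi}{L^2}\sum_{n=1}^N q_nz_n ,$$ for functions $\phi:\mathbb{R}^3\to\mathbb{R}$ that are $L$-periodic in the first two coordinates, locally integrable, and continuous away from the points $\mathbf{x}_n-\tilde{\mathbf{p}}$; the equation is understood in the sense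 of distributions and the limits are uniform in $\mathbf{r}$. This problem has a solution, and the solution is unique away from the points $\mathbf{x}_n-\tilde{\mathbf{p}}$. For every $\xi>0$ and every $m\in\{1,\dots,N\}$, the potential at the $m$-th particle without its self-interaction, $$\phi_m:=\lim_{\mathbf{x}\to\mathbf{x}_m}\Big(\phi(\mathbf{x})-\frac{q_m}{\|\mathbf{x}-\mathbf{x}_m\|}\Big),$$ exists and equals $\phi^R_m+\phi^F_m+\phi^{F,\mathbf{k}=0}_m+\phi^S_m$, where, with $k=\|\mathbf{k}\|$ and $\mathbf{k}$ ranging over $\{2\pi\mathbf{n}/L:\mathbf{n}\in\mathbb{Z}^2\}$, $$\phi^R_m=\sum_{n=1}^N\ \sideset{}{^*}\sum_{\mathbf{p}\in\mathbb{Z}^2}q_n\frac{\mathrm{erfc}(\xi\|\mathbf{x}_m-\mathbf{x}_n+\tilde{\mathbf{p}}\|)}{\|\mathbf{x}_m-\mathbf{x}_n+\tilde{\mathbf{p}}\|},$$ $$\phi^F_m=\frac{2}{L^2}\sum_{n=1}^N\sum_{\mathbf{k}\ne0}\int_{\mathbb{R}}q_n\frac{e^{-(k^2+\kappa^2)/4\xi^2}}{k^2+\kappa^2}e^{i\mathbf{k}\cdot(\mathbf{r}_m-\mathbf{r}_n)}e^{i\kappa(z_m-z_n)}\,d\kappa$$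 $$\phantom{\phi^F_m}=\frac{\pi}{L^2}\sum_{n=1}^N\sum_{\mathbf{k}\ne0}q_n\frac{e^{i\mathbf{k}\cdot(\mathbf{r}_m-\mathbf{r}_n)}}{k}\Big[e^{k(z_m-z_n)}\mathrm{erfc}\Big(\frac{k}{2\xi}+\xi(z_m-z_n)\Big)+e^{-k(z_m-z_n)}\mathrm{erfc}\Big(\frac{k}{2\xi}-\xi(z_m-z_n)\Big)\Big],$$ $$\phi^{F,\mathbf{k}=0}_m=-\frac{2\sqrt\pi}{L^2}\sum_{n=1}^Nq_n\Big(\frac{e^{-\xi^2(z_m-z_n)^2}}{\xi}+\sqrt\pi\,(z_m-z_n)\,\mathrm{erf}(\xi(z_m-z_n))\Big),\qquad \phi^S_m=-\frac{2\xi q_m}{\sqrt\pi}.$$ Here $*$ means that the term $\mathbf{p}=0$ is left out when $n=m$; all series converge absolutely and all integrands are integrable. The same value is the sum of the Coulomb potentials of all periodic images, added cell by cell in symmetric order: $$\phi_m=\lim_{F}\ \sum_{\mathbf{p}\in F}\ \sideset{}{^*}\sum_{n=1}^N\frac{q_n}{\|\mathbf{x}_m-\mathbf{x}_n+\tilde{\mathbf{p}}\|},$$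 the limit being taken over the finite sets $F\subset\mathbb{Z}^2$ with $F=-F$, directed by inclusion. -/

import Mathlib

open MeasureTheory Filter Topology
open scoped ContDiff Laplacian

namespace PlanarEwald

noncomputable section

/-- Three-dimensional Euclidean space; the coordinates `0`, `1` are the periodic directions `x, y`,
the coordinate `2` is the free direction `z`. -/
abbrev Space : Type := EuclideanSpace ℝ (Fin 3)

/-- The plane of the periodic directions. -/
abbrev Plane : Type := EuclideanSpace ℝ (Fin 2)

/-- The error function. -/
def erf (x : ℝ) : ℝ := 2 / √Real.pi * ∫ t in (0 : ℝ)..x, Real.exp (-t ^ 2)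

/-- The complementary error function. -/
def erfc (x : ℝ) : ℝ := 2 / √Real.pi * ∫ t in Set.Ioi x, Real.exp (-t ^ 2)

/-- The lattice translation `L (p₁, p₂, 0)`. -/
def shift (L : ℝ) (p : ℤ × ℤ) : Space := !₂[L * (p.1 : ℝ), L * (p.2 : ℝ), 0]

/-- The component of a vector in the periodic directions. -/
def planar (v : Space) : Plane := !₂[v 0, v 1]

/-- The wave vector `2π n / L` with index `n`. -/
def waveVec (L : ℝ) (n : ℤ × ℤ) : Plane :=
  !₂[2 * Real.pi * (n.1 : ℝ) / L, 2 * Real.pi * (n.2 : ℝ) / L]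

/-- The points occupied by the charges and by their periodic images. -/
def sites {N : ℕ} (L : ℝ) (x : Fin N → Space) : Set Space :=
  {y | ∃ n p, y = x n - shift L p}

/-- `φ` is a solution of the planar-periodic Poisson problem
`-Δ φ = 4π ∑ₙ ∑ₚ qₙ δ(· - xₙ + L(p₁, p₂, 0))`, `φ → ± (2π/L²) ∑ₙ qₙ zₙ` as `z → ± ∞`:
the equation holds in the sense of distributions, `φ` is the representative that is continuous
away from the charges, and the limits are uniform in the periodic directions. The values of `φ`
on the set of charges play no role. -/
structure IsPotential {N : ℕ} (L : ℝ) (q : Fin N → ℝ) (x : Fin N → Space) (φ : Space → ℝ) :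
    Prop where
  periodic : ∀ (p : ℤ × ℤ) (y : Space), φ (y + shift L p) = φ y
  locallyIntegrable : LocallyIntegrable φ volume
  continuousOn : ContinuousOn φ (sites L x)ᶜ
  poisson : ∀ ψ : Space → ℝ, ContDiff ℝ ∞ ψ → HasCompactSupport ψ →
    ∫ y, φ y * (-(Δ ψ y)) = 4 * Real.pi * ∑ n, ∑' p : ℤ × ℤ, q n * ψ (x n - shift L p)
  tendsto_top : Tendsto φ (comap (fun y : Space => y 2) atTop)
    (𝓝 (2 * Real.pi / L ^ 2 * ∑ n, q n * x n 2))
  tendsto_bot : Tendsto φ (comap (fun y : Space => y 2) atBot)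
    (𝓝 (-(2 * Real.pi / L ^ 2 * ∑ n, q n * x n 2)))

/-- The filter of finite subsets of `ℤ²` that are symmetric about the origin, ordered by
inclusion. -/
def symmetricFinsets : Filter (Finset (ℤ × ℤ)) :=
  atTop ⊓ 𝓟 {F | ∀ p ∈ F, -p ∈ F}

/-- The Coulomb potential at the `m`-th particle of all particles in the cell with index `p`; the
particle itself (`n = m`, `p = 0`) is left out. -/
def coulombCell {N : ℕ} (L : ℝ) (q : Fin N → ℝ) (x : Fin N → Space) (m : Fin N) (p : ℤ × ℤ) : ℝ :=
  ∑ n, if n = m ∧ p = 0 then 0 else q n / ‖x m - x n + shift L p‖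

/-- A term of the real-space sum; the term `n = m`, `p = 0` is left out. -/
def realTerm {N : ℕ} (L ξ : ℝ) (q : Fin N → ℝ) (x : Fin N → Space) (m n : Fin N) (p : ℤ × ℤ) : ℝ :=
  if n = m ∧ p = 0 then 0
  else q n * (erfc (ξ * ‖x m - x n + shift L p‖) / ‖x m - x n + shift L p‖)

/-- The real-space part. -/
def realPart {N : ℕ} (L ξ : ℝ) (q : Fin N → ℝ) (x : Fin N → Space) (m : Fin N) : ℝ :=
  ∑ n, ∑' p : ℤ × ℤ, realTerm L ξ q x m n p

/-- The integrand of the mixed Fourier series and integral, for the wave vector `k` and the wave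
number `κ` in the free direction. -/
def fourierIntegrand {N : ℕ} (ξ : ℝ) (q : Fin N → ℝ) (x : Fin N → Space) (m n : Fin N)
    (k : Plane) (κ : ℝ) : ℂ :=
  (q n : ℂ) * ((Real.exp (-(‖k‖ ^ 2 + κ ^ 2) / (4 * ξ ^ 2)) / (‖k‖ ^ 2 + κ ^ 2) : ℝ) : ℂ)
    * Complex.exp (Complex.I * ((inner ℝ k (planar (x m - x n)) : ℝ) : ℂ))
    * Complex.exp (Complex.I * ((κ * (x m 2 - x n 2) : ℝ) : ℂ))

/-- The k-space part without `k = 0`, as a Fourier series in the periodic directions and a Fourier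
integral in the free direction. -/
def fourierPart {N : ℕ} (L ξ : ℝ) (q : Fin N → ℝ) (x : Fin N → Space) (m : Fin N) : ℂ :=
  2 / (L : ℂ) ^ 2 * ∑ n, ∑' j : {j : ℤ × ℤ // j ≠ 0},
    ∫ κ : ℝ, fourierIntegrand ξ q x m n (waveVec L j) κ

/-- A term of the closed form of the k-space sum. -/
def closedTerm {N : ℕ} (ξ : ℝ) (q : Fin N → ℝ) (x : Fin N → Space) (m n : Fin N) (k : Plane) : ℂ :=
  (q n : ℂ) * (Complex.exp (Complex.I * ((inner ℝ k (planar (x m - x n)) : ℝ) : ℂ)) / (‖k‖ : ℂ))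
    * ((Real.exp (‖k‖ * (x m 2 - x n 2)) * erfc (‖k‖ / (2 * ξ) + ξ * (x m 2 - x n 2))
      + Real.exp (-(‖k‖ * (x m 2 - x n 2))) * erfc (‖k‖ / (2 * ξ) - ξ * (x m 2 - x n 2)) : ℝ) : ℂ)

/-- The k-space part without `k = 0`, in closed form. -/
def closedPart {N : ℕ} (L ξ : ℝ) (q : Fin N → ℝ) (x : Fin N → Space) (m : Fin N) : ℂ :=
  (Real.pi : ℂ) / (L : ℂ) ^ 2 * ∑ n, ∑' j : {j : ℤ × ℤ // j ≠ 0},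
    closedTerm ξ q x m n (waveVec L j)

/-- The contribution of `k = 0`. -/
def zeroModePart {N : ℕ} (L ξ : ℝ) (q : Fin N → ℝ) (x : Fin N → Space) (m : Fin N) : ℝ :=
  -(2 * √Real.pi / L ^ 2) * ∑ n, q n * (Real.exp (-(ξ ^ 2 * (x m 2 - x n 2) ^ 2)) / ξ
    + √Real.pi * (x m 2 - x n 2) * erf (ξ * (x m 2 - x n 2)))

/-- The self term. -/
def selfPart {N : ℕ} (ξ : ℝ) (q : Fin N → ℝ) (m : Fin N) : ℝ :=
  -(q m * (2 * ξ / √Real.pi))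

end

end PlanarEwald

/-!
The Coulomb kernel is split with Gaussians, `1 / r = erfc (ξ r) / r + 2 / √π ∫₀^ξ exp (-t² r²) dt`
(`inv_norm_eq_erfc_add`). When the cells `p` and `-p` are added together, neutrality cancels the
monopole and the sign symmetry cancels the dipole in the plane, so that the terms of the long-range
part are at most a constant times `∫₀^ξ t² exp (-t² ‖L p‖² / 4) dt`, uniformly for particles in a
ball. These bounds are summable because a Gaussian lattice sum is of order `t⁻²`. Hence the
symmetric Coulomb sum `pot` converges absolutely, and sum and integral may be interchanged
(`exists_symCell_bound`, `hasSum_symCell`).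

Under the integral stands the periodised Gaussian, and Poisson summation
(`gaussSum_eq_tsum_waveVec`) turns it into plane waves. Integrating each mode over `t` gives the
closed form with `erfc` (`widthIntegral_eq`); the mode zero is integrable by neutrality and gives the
term with `erf` (`integral_exp_neg_sub_one_div_sq`). The Fourier integral in the free direction has the same value,
since `exp (-A / 4ξ²) / A` is itself an integral over `t` (`integral_fourierKernel`). At a particle
the convention `1 / 0 = 0` leaves out the self-interaction in the Coulomb and the short-range sum,
but not in the long-range part, whence the self term (`ewald_eq_pot`).

The function `pot` solves the Poisson problem (`isPotential_pot`): it is periodic by the Ewald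
representation, the limits in the free direction are those of the mode zero, and the equation
follows term by term from the fundamental solution `1 / ‖y - a‖`
(`integral_inv_norm_mul_neg_laplacian`), for which the Laplacian of a Gaussian is written as a
derivative in `t`. The potential at a particle is the value of `pot` there, as the remaining terms
are continuous (`continuousAt_pot_sub`).

Uniqueness (`IsPotential.eqOn`): the mollified difference of two solutions is smooth, harmonic,
periodic and tends to zero in the free direction, so that it vanishes by the maximum principle
(`nonpos_of_harmonic`); off the charges the difference is the limit of its mollifications.
-/

namespace PlanarEwald

/-! ### Gaussian lattice sums -/

lemma norm_add_shift_sq (L : ℝ) (v : Space) (p : ℤ × ℤ) :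
    ‖v + shift L p‖ ^ 2 = (v 0 + L * p.1) ^ 2 + (v 1 + L * p.2) ^ 2 + v 2 ^ 2 := by
  simp [EuclideanSpace.norm_sq_eq, Fin.sum_univ_three, shift]

lemma norm_shift_sq (L : ℝ) (p : ℤ × ℤ) :
    ‖shift L p‖ ^ 2 = L ^ 2 * (p.1 : ℝ) ^ 2 + L ^ 2 * (p.2 : ℝ) ^ 2 := by
  simp [EuclideanSpace.norm_sq_eq, Fin.sum_univ_three, shift, mul_pow]

lemma shift_neg (L : ℝ) (p : ℤ × ℤ) : shift L (-p) = -shift L p := by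
  ext i; fin_cases i <;> simp [shift]

lemma shift_add (L : ℝ) (p e : ℤ × ℤ) : shift L (p + e) = shift L p + shift L e := by
  ext i; fin_cases i <;> simp [shift, mul_add]

lemma shift_zero (L : ℝ) : shift L 0 = 0 := by
  ext i; fin_cases i <;> simp [shift]

lemma norm_waveVec_sq (L : ℝ) (j : ℤ × ℤ) :
    ‖waveVec L j‖ ^ 2 = (2 * Real.pi / L) ^ 2 * (j.1 : ℝ) ^ 2
      + (2 * Real.pi / L) ^ 2 * (j.2 : ℝ) ^ 2 := by
  simp [EuclideanSpace.norm_sq_eq, Fin.sum_univ_two, waveVec]; ring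

lemma inner_waveVec (L : ℝ) (j : ℤ × ℤ) (v : Space) :
    inner ℝ (waveVec L j) (planar v)
      = 2 * Real.pi * j.1 * v 0 / L + 2 * Real.pi * j.2 * v 1 / L := by
  simp [PiLp.inner_apply, Fin.sum_univ_two, waveVec, planar]; ring

lemma summable_exp_neg_mul_int_sq {c : ℝ} (hc : 0 < c) :
    Summable fun n : ℤ => Real.exp (-(c * (n : ℝ) ^ 2)) := by
  have h := ((summable_jacobiTheta₂_term_iff 0 (Complex.I * (c / Real.pi : ℝ))).2
    (by simp; positivity)).norm
  refine h.congr fun n => ?_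
  rw [norm_jacobiTheta₂_term]
  congr 1
  simp
  field_simp

lemma summable_exp_neg_mul_prod_sq {c : ℝ} (hc : 0 < c) :
    Summable fun p : ℤ × ℤ => Real.exp (-(c * (p.1 : ℝ) ^ 2 + c * (p.2 : ℝ) ^ 2)) := by
  have h := summable_exp_neg_mul_int_sq hc
  refine (h.mul_of_nonneg h (fun _ => (Real.exp_pos _).le) fun _ => (Real.exp_pos _).le).congr
    fun p => ?_
  rw [← Real.exp_add]; congr 1; ring

lemma summable_exp_neg_norm_shift {L c : ℝ} (hL : 0 < L) (hc : 0 < c) :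
    Summable fun p : ℤ × ℤ => Real.exp (-(c * ‖shift L p‖ ^ 2)) := by
  refine (summable_exp_neg_mul_prod_sq (c := c * L ^ 2) (by positivity)).congr fun p => ?_
  rw [norm_shift_sq]; congr 1; ring

lemma summable_exp_neg_norm_waveVec {L c : ℝ} (hL : 0 < L) (hc : 0 < c) :
    Summable fun j : ℤ × ℤ => Real.exp (-(c * ‖waveVec L j‖ ^ 2)) := by
  refine (summable_exp_neg_mul_prod_sq (c := c * (2 * Real.pi / L) ^ 2)
    (by positivity)).congr fun p => ?_
  rw [norm_waveVec_sq]; congr 1; ring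

lemma half_norm_sq_sub_le (v w : Space) : ‖w‖ ^ 2 / 2 - ‖v‖ ^ 2 ≤ ‖v + w‖ ^ 2 := by
  have h : ‖w‖ ≤ ‖v + w‖ + ‖v‖ := by
    simpa using norm_sub_le (v + w) v
  nlinarith [sq_nonneg (‖v + w‖ - ‖v‖), norm_nonneg w, norm_nonneg v, norm_nonneg (v + w)]

lemma exp_neg_norm_add_le {c : ℝ} (hc : 0 ≤ c) (v w : Space) :
    Real.exp (-(c * ‖v + w‖ ^ 2)) ≤ Real.exp (c * ‖v‖ ^ 2) * Real.exp (-(c / 2 * ‖w‖ ^ 2)) := by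
  rw [← Real.exp_add]
  apply Real.exp_le_exp.2
  nlinarith [half_norm_sq_sub_le v w]

lemma summable_exp_neg_norm_add_shift {L c : ℝ} (hL : 0 < L) (hc : 0 < c) (v : Space) :
    Summable fun p : ℤ × ℤ => Real.exp (-(c * ‖v + shift L p‖ ^ 2)) :=
  .of_nonneg_of_le (fun _ => (Real.exp_pos _).le)
    (fun p => exp_neg_norm_add_le hc.le v (shift L p))
    ((summable_exp_neg_norm_shift hL (half_pos hc)).mul_left _)

/-- The function `∑ₚ exp (-t² ‖v + L p‖²)`, the periodisation of a Gaussian of width `1 / t`. -/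
noncomputable def gaussSum (L t : ℝ) (v : Space) : ℝ :=
  ∑' p : ℤ × ℤ, Real.exp (-(t ^ 2 * ‖v + shift L p‖ ^ 2))

lemma gaussSum_one_dim {L t : ℝ} (hL : 0 < L) (ht : 0 < t) (a : ℝ) :
    ∑' n : ℤ, (Real.exp (-(t ^ 2 * (a + L * n) ^ 2)) : ℂ)
      = (√Real.pi / (t * L) : ℝ) * ∑' n : ℤ, (Real.exp (-((Real.pi * n / (t * L)) ^ 2)) : ℂ)
        * Complex.exp (Complex.I * (2 * Real.pi * n * a / L : ℝ)) := by
  have hπ := Real.pi_pos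
  set A : ℝ := t ^ 2 * L ^ 2 / Real.pi with hA
  have hApos : 0 < A := by positivity
  set b : ℝ := -(t ^ 2 * a * L / Real.pi) with hb
  have key := Complex.tsum_exp_neg_quadratic (a := (A : ℂ)) (by simpa using hApos) (b : ℂ)
  have h1 : ∀ n : ℤ, (Real.exp (-(t ^ 2 * (a + L * n) ^ 2)) : ℂ)
      = (Real.exp (-(t ^ 2 * a ^ 2)) : ℂ)
        * Complex.exp (-Real.pi * A * n ^ 2 + 2 * Real.pi * b * n) := by
    intro n
    rw [Complex.ofReal_exp, Complex.ofReal_exp, ← Complex.exp_add]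
    congr 1
    have : (Real.pi : ℂ) ≠ 0 := by exact_mod_cast hπ.ne'
    rw [hA, hb]; push_cast
    field_simp
    ring
  have h2 : ∀ n : ℤ, Complex.exp (-Real.pi / A * (n + Complex.I * b) ^ 2)
      = (Real.exp (t ^ 2 * a ^ 2) : ℂ) * ((Real.exp (-((Real.pi * n / (t * L)) ^ 2)) : ℂ)
        * Complex.exp (Complex.I * (2 * Real.pi * n * a / L : ℝ))) := by
    intro n
    rw [Complex.ofReal_exp, Complex.ofReal_exp, ← Complex.exp_add, ← Complex.exp_add]
    congr 1
    have h0 : (Real.pi : ℂ) ≠ 0 := by exact_mod_cast hπ.ne'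
    have h1 : (t : ℂ) ≠ 0 := by exact_mod_cast ht.ne'
    have h2 : (L : ℂ) ≠ 0 := by exact_mod_cast hL.ne'
    rw [hA, hb]; push_cast
    field_simp
    ring_nf
    simp only [Complex.I_sq]
    ring
  have h3 : 1 / (A : ℂ) ^ (1 / 2 : ℂ) = (√Real.pi / (t * L) : ℝ) := by
    have : (A : ℂ) ^ (1 / 2 : ℂ) = ((√A : ℝ) : ℂ) := by
      rw [Real.sqrt_eq_rpow, Complex.ofReal_cpow hApos.le]; simp
    rw [this, hA, Real.sqrt_div (by positivity), ← mul_pow, Real.sqrt_sq (by positivity)]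
    push_cast
    rw [one_div_div]
  simp_rw [h1, h2] at key ⊢
  rw [tsum_mul_left, key, tsum_mul_left, h3]
  have h4 : (Real.exp (-(t ^ 2 * a ^ 2)) : ℂ) * (Real.exp (t ^ 2 * a ^ 2) : ℂ) = 1 := by
    rw [← Complex.ofReal_mul, ← Real.exp_add]; simp
  linear_combination ((√Real.pi / (t * L) : ℝ) * ∑' n : ℤ,
    (Real.exp (-((Real.pi * n / (t * L)) ^ 2)) : ℂ)
        * Complex.exp (Complex.I * (2 * Real.pi * n * a / L : ℝ))) * h4

/-- The Poisson summation formula for a Gaussian on the planar lattice. -/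
lemma gaussSum_eq_tsum_waveVec {L t : ℝ} (hL : 0 < L) (ht : 0 < t) (v : Space) :
    (gaussSum L t v : ℂ) = (Real.pi / L ^ 2 * (Real.exp (-(t ^ 2 * v 2 ^ 2)) / t ^ 2) : ℝ)
      * ∑' j : ℤ × ℤ, (Real.exp (-(‖waveVec L j‖ ^ 2 / (4 * t ^ 2))) : ℂ)
        * Complex.exp (Complex.I * (inner ℝ (waveVec L j) (planar v) : ℝ)) := by
  have hπ := Real.pi_pos
  have hs : ∀ a : ℝ, Summable fun n : ℤ => (Real.exp (-(t ^ 2 * (a + L * n) ^ 2)) : ℂ) := by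
    intro a
    refine Summable.of_norm_bounded ((summable_exp_neg_mul_int_sq
      (c := t ^ 2 * L ^ 2 / 2) (by positivity)).mul_left (Real.exp (t ^ 2 * a ^ 2))) fun n => ?_
    rw [Complex.norm_real, Real.norm_eq_abs, Real.abs_exp, ← Real.exp_add]
    apply Real.exp_le_exp.2
    have : 0 ≤ t ^ 2 * (2 * a + L * n) ^ 2 := by positivity
    linarith
  have hs' : ∀ a : ℝ, Summable fun n : ℤ => (Real.exp (-((Real.pi * n / (t * L)) ^ 2)) : ℂ)
        * Complex.exp (Complex.I * (2 * Real.pi * n * a / L : ℝ)) := by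
    intro a
    refine Summable.of_norm_bounded (summable_exp_neg_mul_int_sq
      (c := (Real.pi / (t * L)) ^ 2) (by positivity)) fun n => ?_
    rw [norm_mul, Complex.norm_exp_I_mul_ofReal, mul_one, Complex.norm_real, Real.norm_eq_abs,
      Real.abs_exp]
    apply le_of_eq; congr 1; ring
  have h1 : (gaussSum L t v : ℂ) = (Real.exp (-(t ^ 2 * v 2 ^ 2)) : ℂ)
      * ((∑' n : ℤ, (Real.exp (-(t ^ 2 * (v 0 + L * n) ^ 2)) : ℂ))
        * ∑' n : ℤ, (Real.exp (-(t ^ 2 * (v 1 + L * n) ^ 2)) : ℂ)) := by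
    rw [tsum_mul_tsum_of_summable_norm (hs _).norm (hs _).norm, gaussSum, Complex.ofReal_tsum,
      ← tsum_mul_left]
    congr 1; ext p
    rw [← Complex.ofReal_mul, ← Complex.ofReal_mul, ← Real.exp_add, ← Real.exp_add,
      norm_add_shift_sq]
    congr 2; ring
  rw [h1, gaussSum_one_dim hL ht, gaussSum_one_dim hL ht, mul_mul_mul_comm,
    tsum_mul_tsum_of_summable_norm (hs' _).norm (hs' _).norm]
  have h2 : ∀ j : ℤ × ℤ, (Real.exp (-(‖waveVec L j‖ ^ 2 / (4 * t ^ 2))) : ℂ)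
        * Complex.exp (Complex.I * (inner ℝ (waveVec L j) (planar v) : ℝ))
      = ((Real.exp (-((Real.pi * j.1 / (t * L)) ^ 2)) : ℂ)
        * Complex.exp (Complex.I * (2 * Real.pi * j.1 * v 0 / L : ℝ)))
      * ((Real.exp (-((Real.pi * j.2 / (t * L)) ^ 2)) : ℂ)
        * Complex.exp (Complex.I * (2 * Real.pi * j.2 * v 1 / L : ℝ))) := by
    intro j
    rw [mul_mul_mul_comm, ← Complex.ofReal_mul, ← Real.exp_add, ← Complex.exp_add, inner_waveVec,
      norm_waveVec_sq]
    congr 2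
    · congr 2; field_simp; ring
    · push_cast; ring
  simp_rw [h2]
  rw [← mul_assoc]
  congr 1
  rw [← Complex.ofReal_mul, ← Complex.ofReal_mul]
  congr 1
  have := Real.mul_self_sqrt hπ.le
  field_simp
  nlinarith [this]

/-! ### The error function and Gaussian integrals in the width parameter -/

lemma continuous_exp_neg_sq : Continuous fun t : ℝ => Real.exp (-t ^ 2) := by fun_prop

lemma integrable_exp_neg_sq : Integrable fun t : ℝ => Real.exp (-t ^ 2) := by
  simpa using integrable_exp_neg_mul_sq one_pos

lemma erf_zero : erf 0 = 0 := by simp [erf]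

lemma hasDerivAt_erf (x : ℝ) : HasDerivAt erf (2 / √Real.pi * Real.exp (-x ^ 2)) x :=
  (intervalIntegral.integral_hasDerivAt_right (continuous_exp_neg_sq.intervalIntegrable _ _)
    (continuous_exp_neg_sq.stronglyMeasurableAtFilter _ _)
    continuous_exp_neg_sq.continuousAt).const_mul _

lemma continuous_erf : Continuous erf :=
  continuous_iff_continuousAt.2 fun x => (hasDerivAt_erf x).continuousAt

lemma erfc_zero : erfc 0 = 1 := by
  have h := integral_gaussian_Ioi 1
  simp only [neg_mul, one_mul, div_one] at h
  have := Real.sqrt_pos.2 Real.pi_pos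
  rw [erfc, h]; field_simp

lemma erfc_eq_one_sub_erf (x : ℝ) : erfc x = 1 - erf x := by
  have h := intervalIntegral.integral_Ioi_sub_Ioi' (a := 0) (b := x)
    integrable_exp_neg_sq.integrableOn integrable_exp_neg_sq.integrableOn
  rw [← erfc_zero, erfc, erfc, erf, ← h]; ring

lemma hasDerivAt_erfc (x : ℝ) : HasDerivAt erfc (-(2 / √Real.pi * Real.exp (-x ^ 2))) x := by
  rw [funext erfc_eq_one_sub_erf]
  exact (hasDerivAt_erf x).const_sub 1

lemma erfc_nonneg (x : ℝ) : 0 ≤ erfc x :=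
  mul_nonneg (by positivity) (integral_nonneg fun _ => (Real.exp_pos _).le)

lemma erfc_le_exp_neg_sq {x : ℝ} (hx : 0 ≤ x) : erfc x ≤ Real.exp (-x ^ 2) := by
  have h0 : ∫ t in Set.Ioi x, Real.exp (-t ^ 2)
      = ∫ u in Set.Ioi (0 : ℝ), Real.exp (-(u + x) ^ 2) := by
    have := (measurePreserving_add_right volume x).setIntegral_preimage_emb
      (measurableEmbedding_addRight x) (fun t => Real.exp (-t ^ 2)) (Set.Ioi x)
    simpa using this.symm
  have h1 : ∫ u in Set.Ioi (0 : ℝ), Real.exp (-(u + x) ^ 2)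
      ≤ ∫ u in Set.Ioi (0 : ℝ), Real.exp (-x ^ 2) * Real.exp (-u ^ 2) := by
    refine setIntegral_mono_on (integrable_exp_neg_sq.comp_add_right x).integrableOn
      (integrable_exp_neg_sq.const_mul _).integrableOn measurableSet_Ioi fun u hu => ?_
    rw [← Real.exp_add]
    apply Real.exp_le_exp.2
    have : 0 ≤ u * x := mul_nonneg (le_of_lt hu) hx
    nlinarith
  rw [integral_const_mul] at h1
  have h2 := erfc_zero
  rw [erfc] at h2 ⊢
  rw [h0]
  calc _ ≤ 2 / √Real.pi * (Real.exp (-x ^ 2) * ∫ u in Set.Ioi (0 : ℝ), Real.exp (-u ^ 2)) := by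
        gcongr
    _ = Real.exp (-x ^ 2) * (2 / √Real.pi * ∫ u in Set.Ioi (0 : ℝ), Real.exp (-u ^ 2)) := by ring
    _ = _ := by rw [h2, mul_one]

lemma erf_neg (x : ℝ) : erf (-x) = -erf x := by
  have := intervalIntegral.integral_comp_neg (a := 0) (b := x) (fun t => Real.exp (-t ^ 2))
  simp only [even_two.neg_pow, neg_zero] at this
  rw [erf, erf, this, intervalIntegral.integral_symm]; ring

lemma tendsto_exp_neg_sq_atTop : Tendsto (fun x : ℝ => Real.exp (-x ^ 2)) atTop (𝓝 0) :=
  Real.tendsto_exp_atBot.comp (tendsto_neg_atTop_atBot.comp (tendsto_pow_atTop two_ne_zero))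

lemma tendsto_erfc_atTop : Tendsto erfc atTop (𝓝 0) :=
  tendsto_of_tendsto_of_tendsto_of_le_of_le' tendsto_const_nhds tendsto_exp_neg_sq_atTop
    (Eventually.of_forall erfc_nonneg)
    ((eventually_ge_atTop 0).mono fun _ hx => erfc_le_exp_neg_sq hx)

lemma erf_nonneg {x : ℝ} (hx : 0 ≤ x) : 0 ≤ erf x := by
  have h1 := erfc_eq_one_sub_erf x
  have h2 := erfc_le_exp_neg_sq hx
  have h3 : Real.exp (-x ^ 2) ≤ 1 := Real.exp_le_one_iff.2 (by nlinarith)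
  linarith

lemma erf_le_one (x : ℝ) : erf x ≤ 1 := by
  have h1 := erfc_eq_one_sub_erf x
  have h2 := erfc_nonneg x
  linarith

lemma tendsto_erf_atTop : Tendsto erf atTop (𝓝 1) := by
  have h := tendsto_erfc_atTop.const_sub 1
  simpa [erfc_eq_one_sub_erf] using h

/-- The Gaussian integral representation of the long-range part of the Coulomb kernel. -/
lemma integral_exp_neg_sq_mul_sq (ξ : ℝ) {r : ℝ} (hr : r ≠ 0) :
    2 / √Real.pi * ∫ t in (0 : ℝ)..ξ, Real.exp (-(t ^ 2 * r ^ 2)) = erf (ξ * r) / r := by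
  have := intervalIntegral.integral_comp_mul_right (a := 0) (b := ξ)
    (fun t => Real.exp (-t ^ 2)) hr
  simp only [mul_pow, zero_mul, smul_eq_mul] at this
  rw [this, erf]; field_simp

/-- The splitting of the Coulomb kernel into a short-range and a smooth long-range part. At the
origin, where the quotients are zero by convention, the long-range part is compensated. -/
lemma inv_norm_eq_erfc_add (ξ : ℝ) (v : Space) :
    1 / ‖v‖ = erfc (ξ * ‖v‖) / ‖v‖
      + 2 / √Real.pi * (∫ t in (0 : ℝ)..ξ, Real.exp (-(t ^ 2 * ‖v‖ ^ 2)))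
      - if v = 0 then 2 * ξ / √Real.pi else 0 := by
  split_ifs with h
  · subst h; simp; ring
  · rw [integral_exp_neg_sq_mul_sq ξ (norm_ne_zero_iff.2 h), erfc_eq_one_sub_erf]; ring

lemma mul_exp_neg_le_one (x : ℝ) : x * Real.exp (-x) ≤ 1 := by
  have h := Real.add_one_le_exp x
  have := Real.exp_pos (-x)
  calc x * Real.exp (-x) ≤ Real.exp x * Real.exp (-x) := by gcongr; linarith
    _ = 1 := by rw [← Real.exp_add]; simp

/-- The integral over the Gaussian width that yields the closed form of the k-space terms. -/
noncomputable def widthIntegral (ξ k z : ℝ) : ℝ :=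
  ∫ t in (0 : ℝ)..ξ, Real.exp (-(k ^ 2 / (4 * t ^ 2))) * (Real.exp (-(t ^ 2 * z ^ 2)) / t ^ 2)

/-- With `k ^ 2 ≥ a`, half of the exponent absorbs the singular factor `t⁻²`, the other half decays
in `k`. -/
lemma widthIntegrand_le {a k ξ : ℝ} (ha : 0 < a) (hk : a ≤ k ^ 2) (z : ℝ) {t : ℝ} (ht : 0 < t)
    (htξ : t ≤ ξ) :
    Real.exp (-(k ^ 2 / (4 * t ^ 2))) * (Real.exp (-(t ^ 2 * z ^ 2)) / t ^ 2)
      ≤ 8 / a * Real.exp (-(1 / (8 * ξ ^ 2) * k ^ 2)) * Real.exp (-(t ^ 2 * z ^ 2)) := by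
  have h1 : Real.exp (-(k ^ 2 / (4 * t ^ 2)))
      = Real.exp (-(k ^ 2 / (8 * t ^ 2))) * Real.exp (-(k ^ 2 / (8 * t ^ 2))) := by
    rw [← Real.exp_add]; congr 1; field_simp; ring
  have h2 : Real.exp (-(k ^ 2 / (8 * t ^ 2))) / t ^ 2 ≤ 8 / a := by
    have := mul_exp_neg_le_one (k ^ 2 / (8 * t ^ 2))
    rw [div_mul_eq_mul_div, div_le_one (by positivity)] at this
    rw [div_le_div_iff₀ (by positivity) ha]
    calc _ = a * Real.exp (-(k ^ 2 / (8 * t ^ 2))) := by ring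
      _ ≤ k ^ 2 * Real.exp (-(k ^ 2 / (8 * t ^ 2))) := by gcongr
      _ ≤ _ := this
  have h3 : Real.exp (-(k ^ 2 / (8 * t ^ 2))) ≤ Real.exp (-(1 / (8 * ξ ^ 2) * k ^ 2)) := by
    apply Real.exp_le_exp.2
    rw [neg_le_neg_iff, one_div_mul_eq_div]
    gcongr
  calc _ = (Real.exp (-(k ^ 2 / (8 * t ^ 2))) / t ^ 2) * Real.exp (-(k ^ 2 / (8 * t ^ 2)))
          * Real.exp (-(t ^ 2 * z ^ 2)) := by rw [h1]; ring
    _ ≤ _ := by gcongr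

lemma measurable_widthIntegrand (k z : ℝ) : Measurable fun t : ℝ =>
    Real.exp (-(k ^ 2 / (4 * t ^ 2))) * (Real.exp (-(t ^ 2 * z ^ 2)) / t ^ 2) := by fun_prop

/-- A bound on `(0, ξ]` suffices; the value at the singular end point `0` does not matter. -/
lemma intervalIntegrable_of_bound {f : ℝ → ℝ} {ξ C : ℝ} (hξ : 0 ≤ ξ) (hf : Measurable f)
    (h : ∀ t, 0 < t → t ≤ ξ → |f t| ≤ C) : IntervalIntegrable f volume 0 ξ := by
  rw [intervalIntegrable_iff_integrableOn_Ioc_of_le hξ]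
  exact Measure.integrableOn_of_bounded (M := C) (by simp) hf.aestronglyMeasurable
    ((ae_restrict_iff' measurableSet_Ioc).2 (Eventually.of_forall fun t ht => h t ht.1 ht.2))

lemma widthIntegrand_le_const {k : ℝ} (hk : k ≠ 0) (ξ z : ℝ) {t : ℝ} (ht : 0 < t) (htξ : t ≤ ξ) :
    |Real.exp (-(k ^ 2 / (4 * t ^ 2))) * (Real.exp (-(t ^ 2 * z ^ 2)) / t ^ 2)| ≤ 8 / k ^ 2 := by
  rw [abs_of_nonneg (by positivity)]
  refine (widthIntegrand_le (a := k ^ 2) (by positivity) le_rfl z ht htξ).trans ?_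
  rw [mul_assoc, ← Real.exp_add]
  refine mul_le_of_le_one_right (by positivity) (Real.exp_le_one_iff.2 ?_)
  have : 0 ≤ 1 / (8 * ξ ^ 2) * k ^ 2 := by positivity
  nlinarith [mul_nonneg (sq_nonneg t) (sq_nonneg z)]

lemma intervalIntegrable_widthIntegrand {ξ k : ℝ} (hξ : 0 ≤ ξ) (hk : k ≠ 0) (z : ℝ) :
    IntervalIntegrable (fun t : ℝ =>
      Real.exp (-(k ^ 2 / (4 * t ^ 2))) * (Real.exp (-(t ^ 2 * z ^ 2)) / t ^ 2)) volume 0 ξ :=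
  intervalIntegrable_of_bound hξ (measurable_widthIntegrand k z)
    fun _ ht htξ => widthIntegrand_le_const hk ξ z ht htξ

lemma tendsto_div_mul_nhdsGT_zero {k : ℝ} (hk : 0 < k) (z : ℝ) :
    Tendsto (fun t : ℝ => k / (2 * t) + t * z) (𝓝[>] 0) atTop := by
  have h1 : Tendsto (fun t : ℝ => k / 2 * t⁻¹) (𝓝[>] 0) atTop :=
    tendsto_inv_nhdsGT_zero.const_mul_atTop (half_pos hk)
  have h2 : Tendsto (fun t : ℝ => t * z) (𝓝[>] 0) (𝓝 (0 * z)) :=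
    ((continuous_id.mul continuous_const).tendsto 0).mono_left nhdsWithin_le_nhds
  refine (h1.atTop_add h2).congr fun t => ?_
  rw [mul_comm 2 t, ← div_div, div_right_comm]; rfl

/-- The closed form of the width integral, by the fundamental theorem of calculus; the limit of the
primitive at `0` vanishes because `erfc` does at `+∞`. -/
lemma widthIntegral_eq {ξ k : ℝ} (hξ : 0 < ξ) (hk : 0 < k) (z : ℝ) :
    widthIntegral ξ k z = √Real.pi / (2 * k) * (Real.exp (k * z) * erfc (k / (2 * ξ) + ξ * z)
      + Real.exp (-(k * z)) * erfc (k / (2 * ξ) - ξ * z)) := by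
  have hπ := Real.sqrt_pos.2 Real.pi_pos
  set F : ℝ → ℝ := fun t => √Real.pi / (2 * k) * (Real.exp (k * z) * erfc (k / (2 * t) + t * z)
      + Real.exp (-(k * z)) * erfc (k / (2 * t) + t * (-z))) with hF
  have hd : ∀ t : ℝ, 0 < t → HasDerivAt F
      (Real.exp (-(k ^ 2 / (4 * t ^ 2))) * (Real.exp (-(t ^ 2 * z ^ 2)) / t ^ 2)) t := by
    intro t ht
    have hin : ∀ y : ℝ, HasDerivAt (fun t : ℝ => k / (2 * t) + t * y) (-(k / (2 * t ^ 2)) + y) t := by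
      intro y
      have h := ((hasDerivAt_inv ht.ne').const_mul (k / 2)).add ((hasDerivAt_id t).mul_const y)
      refine (h.congr_of_eventuallyEq ?_).congr_deriv ?_
      · filter_upwards [lt_mem_nhds ht] with s hs
        have : s ≠ 0 := ne_of_gt hs
        simp; field_simp
      · field_simp
    have hA := ((hasDerivAt_erfc _).comp t (hin z)).const_mul (Real.exp (k * z))
    have hB := ((hasDerivAt_erfc _).comp t (hin (-z))).const_mul (Real.exp (-(k * z)))
    refine ((hA.add hB).const_mul (√Real.pi / (2 * k))).congr_deriv ?_
    have e1 : Real.exp (-(k / (2 * t) + t * z) ^ 2)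
        = Real.exp (-(k * z)) * (Real.exp (-(k ^ 2 / (4 * t ^ 2))) * Real.exp (-(t ^ 2 * z ^ 2))) := by
      rw [← Real.exp_add, ← Real.exp_add]; congr 1; field_simp; ring
    have e2 : Real.exp (-(k / (2 * t) + t * (-z)) ^ 2)
        = Real.exp (k * z) * (Real.exp (-(k ^ 2 / (4 * t ^ 2))) * Real.exp (-(t ^ 2 * z ^ 2))) := by
      rw [← Real.exp_add, ← Real.exp_add]; congr 1; field_simp; ring
    have e3 : Real.exp (k * z) * Real.exp (-(k * z)) = 1 := by rw [← Real.exp_add]; simp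
    rw [e1, e2]
    set E := Real.exp (-(k ^ 2 / (4 * t ^ 2))) * Real.exp (-(t ^ 2 * z ^ 2))
    have : √Real.pi / (2 * k) * (Real.exp (k * z) * (-(2 / √Real.pi * (Real.exp (-(k * z)) * E))
        * (-(k / (2 * t ^ 2)) + z)) + Real.exp (-(k * z)) * (-(2 / √Real.pi * (Real.exp (k * z) * E))
        * (-(k / (2 * t ^ 2)) + -z)))
        = (Real.exp (k * z) * Real.exp (-(k * z))) * (E / t ^ 2) := by
      field_simp; ring
    rw [this, e3, one_mul, mul_div_assoc]
  have h0 : Tendsto F (𝓝[>] 0) (𝓝 0) := by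
    have hl : ∀ y : ℝ, Tendsto (fun t : ℝ => erfc (k / (2 * t) + t * y)) (𝓝[>] 0) (𝓝 0) := fun y =>
      tendsto_erfc_atTop.comp (tendsto_div_mul_nhdsGT_zero hk y)
    simpa [hF] using (((hl z).const_mul (Real.exp (k * z))).add
      ((hl (-z)).const_mul (Real.exp (-(k * z))))).const_mul (√Real.pi / (2 * k))
  have h1 : Tendsto F (𝓝[<] ξ) (𝓝 (F ξ)) :=
    (hd ξ hξ).continuousAt.tendsto.mono_left nhdsWithin_le_nhds
  rw [widthIntegral, intervalIntegral.integral_eq_sub_of_hasDerivAt_of_tendsto hξ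
    (fun t ht => hd t ht.1) (intervalIntegrable_widthIntegrand hξ.le hk.ne' z) h0 h1]
  simp [hF, sub_eq_add_neg]

/-- The integral over the Gaussian width for the wave vector zero, where charge neutrality
supplies the counterterm `-1`. -/
lemma integral_exp_neg_sub_one_div_sq {ξ : ℝ} (hξ : 0 < ξ) (z : ℝ) :
    IntervalIntegrable (fun t : ℝ => (Real.exp (-(t ^ 2 * z ^ 2)) - 1) / t ^ 2) volume 0 ξ ∧
    ∫ t in (0 : ℝ)..ξ, (Real.exp (-(t ^ 2 * z ^ 2)) - 1) / t ^ 2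
      = 1 / ξ - (Real.exp (-(ξ ^ 2 * z ^ 2)) / ξ + √Real.pi * z * erf (ξ * z)) := by
  have hπ := Real.sqrt_pos.2 Real.pi_pos
  have hb : ∀ t : ℝ, 0 ≤ 1 - Real.exp (-(t ^ 2 * z ^ 2)) ∧
      1 - Real.exp (-(t ^ 2 * z ^ 2)) ≤ t ^ 2 * z ^ 2 := by
    intro t
    have h0 : Real.exp (-(t ^ 2 * z ^ 2)) ≤ 1 := Real.exp_le_one_iff.2 (by
      nlinarith [mul_nonneg (sq_nonneg t) (sq_nonneg z)])
    have h1 := Real.add_one_le_exp (-(t ^ 2 * z ^ 2))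
    constructor <;> linarith
  have hint : IntervalIntegrable (fun t : ℝ => (Real.exp (-(t ^ 2 * z ^ 2)) - 1) / t ^ 2)
      volume 0 ξ := by
    refine intervalIntegrable_of_bound (C := z ^ 2) hξ.le (by fun_prop) fun t ht _ => ?_
    rw [abs_div, abs_sub_comm, abs_of_nonneg (hb t).1, abs_of_nonneg (by positivity),
      div_le_iff₀ (by positivity)]
    linarith [(hb t).2]
  refine ⟨hint, ?_⟩
  set F : ℝ → ℝ := fun t => (1 - Real.exp (-(t ^ 2 * z ^ 2))) / t - √Real.pi * z * erf (t * z) with hF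
  have hd : ∀ t : ℝ, 0 < t → HasDerivAt F ((Real.exp (-(t ^ 2 * z ^ 2)) - 1) / t ^ 2) t := by
    intro t ht
    have h1 : HasDerivAt (fun t : ℝ => 1 - Real.exp (-(t ^ 2 * z ^ 2)))
        (2 * t * z ^ 2 * Real.exp (-(t ^ 2 * z ^ 2))) t := by
      have := ((((hasDerivAt_pow 2 t).mul_const (z ^ 2)).neg).exp).const_sub 1
      refine this.congr_deriv ?_
      norm_num; ring
    have h2 := (((hasDerivAt_erf (t * z)).comp t ((hasDerivAt_id t).mul_const z))).const_mul
      (√Real.pi * z)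
    refine ((h1.div (hasDerivAt_id t) ht.ne').sub h2).congr_deriv ?_
    simp only [id, mul_pow, one_mul]
    field_simp
    ring
  have h0 : Tendsto F (𝓝[>] 0) (𝓝 0) := by
    have h1 : Tendsto (fun t : ℝ => (1 - Real.exp (-(t ^ 2 * z ^ 2))) / t) (𝓝[>] 0) (𝓝 0) := by
      have hz : Tendsto (fun t : ℝ => t * z ^ 2) (𝓝[>] 0) (𝓝 0) := by
        have : Tendsto (fun t : ℝ => t * z ^ 2) (𝓝 0) (𝓝 (0 * z ^ 2)) :=
          (continuous_id.mul continuous_const).tendsto 0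
        simpa using this.mono_left nhdsWithin_le_nhds
      refine tendsto_of_tendsto_of_tendsto_of_le_of_le' tendsto_const_nhds hz ?_ ?_
      · filter_upwards [self_mem_nhdsWithin] with t ht
        exact div_nonneg (hb t).1 (le_of_lt ht)
      · filter_upwards [self_mem_nhdsWithin] with t ht
        rw [div_le_iff₀ ht]; linarith [(hb t).2]
    have h2 : Tendsto (fun t : ℝ => √Real.pi * z * erf (t * z)) (𝓝[>] 0) (𝓝 0) := by
      have : Continuous fun t : ℝ => √Real.pi * z * erf (t * z) :=
        continuous_const.mul (continuous_erf.comp (continuous_id.mul continuous_const))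
      simpa [erf_zero] using (this.tendsto 0).mono_left nhdsWithin_le_nhds
    simpa using h1.sub h2
  have h1 : Tendsto F (𝓝[<] ξ) (𝓝 (F ξ)) :=
    (hd ξ hξ).continuousAt.tendsto.mono_left nhdsWithin_le_nhds
  rw [intervalIntegral.integral_eq_sub_of_hasDerivAt_of_tendsto hξ (fun t ht => hd t ht.1) hint h0 h1]
  simp [hF]; ring

/-! ### Symmetric summation over the lattice -/

/-- The contribution of the lattice vectors `± L p` to the superposition of the kernel `f` with
weights `q` at the points `v`, averaged over the two signs. -/
noncomputable def symAvg {N : ℕ} (f : Space → ℝ) (L : ℝ) (q : Fin N → ℝ) (v : Fin N → Space)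
    (p : ℤ × ℤ) : ℝ :=
  ∑ n, q n * ((f (v n + shift L p) + f (v n - shift L p)) / 2)

/-- The averaged Coulomb kernel. -/
noncomputable abbrev symCell {N : ℕ} (L : ℝ) (q : Fin N → ℝ) (v : Fin N → Space) (p : ℤ × ℤ) : ℝ :=
  symAvg (fun w => 1 / ‖w‖) L q v p

lemma hasSum_symAvg {N : ℕ} {f : Space → ℝ} {L : ℝ} (q : Fin N → ℝ) {v : Fin N → Space}
    (h : ∀ n, Summable fun p => f (v n + shift L p)) :
    HasSum (symAvg f L q v) (∑ n, q n * ∑' p, f (v n + shift L p)) := by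
  refine hasSum_sum fun n _ => HasSum.mul_left _ ?_
  have h1 := (h n).hasSum
  have h2 : HasSum (fun p => f (v n - shift L p)) (∑' p, f (v n + shift L p)) := by
    have := (Equiv.neg (ℤ × ℤ)).hasSum_iff.2 h1
    refine this.congr_fun fun p => ?_
    simp [shift_neg, sub_eq_add_neg]
  simpa using (h1.add h2).div_const 2

lemma cosh_sub_one_le (b : ℝ) : Real.cosh b - 1 ≤ b ^ 2 / 2 * Real.exp |b| := by
  rw [← Real.cosh_abs, ← sq_abs b]
  have hβ := abs_nonneg b
  set β := |b|
  have h1 := Real.add_one_le_exp (-β)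
  have h2 : Real.exp (-β) ≤ 1 := Real.exp_le_one_iff.2 (by linarith)
  have h3 : Real.exp β * Real.exp (-β) = 1 := by rw [← Real.exp_add]; simp
  have h4 := Real.exp_pos β
  have h5 : Real.cosh β - 1 = Real.exp β * (1 - Real.exp (-β)) ^ 2 / 2 := by
    rw [Real.cosh_eq]; linear_combination (1 - Real.exp (-β) / 2) * h3
  have h6 : (1 - Real.exp (-β)) ^ 2 ≤ β ^ 2 := by
    apply pow_le_pow_left₀ <;> linarith
  rw [h5]
  nlinarith

lemma abs_exp_neg_mul_cosh_sub_one_le {a : ℝ} (ha : 0 ≤ a) (b : ℝ) :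
    |Real.exp (-a) * Real.cosh b - 1| ≤ (a + b ^ 2 / 2) * Real.exp |b| := by
  have h1 := Real.add_one_le_exp (-a)
  have h2 : Real.exp (-a) ≤ 1 := Real.exp_le_one_iff.2 (by linarith)
  have h3 := Real.one_le_cosh b
  have h4 := cosh_sub_one_le b
  have h5 : 1 ≤ Real.exp |b| := Real.one_le_exp (abs_nonneg b)
  have h6 := Real.exp_pos (-a)
  have h7 : a ≤ a * Real.exp |b| := le_mul_of_one_le_right ha h5
  have h8 : 0 ≤ b ^ 2 / 2 * Real.exp |b| := by positivity
  rw [abs_le]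
  constructor <;> nlinarith

/-- The averaged Gaussian at the lattice vector `w`, with its value at `v = 0` subtracted: the
first-order terms in `v` cancel between `w` and `-w`. What remains is a factor `t² R²` times a
Gaussian in `w`, of which a part is used up by the polynomial factors in `t ‖w‖`. -/
lemma abs_gaussian_average_sub_le {R ξ t : ℝ} (ht : 0 < t) (htξ : t ≤ ξ) {v : Space} (hv : ‖v‖ ≤ R)
    (w : Space) :
    |(Real.exp (-(t ^ 2 * ‖v + w‖ ^ 2)) + Real.exp (-(t ^ 2 * ‖v - w‖ ^ 2))) / 2
        - Real.exp (-(t ^ 2 * ‖w‖ ^ 2))|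
      ≤ 9 * R ^ 2 * Real.exp (2 * ξ ^ 2 * R ^ 2) * (t ^ 2 * Real.exp (-((t / 2) ^ 2 * ‖w‖ ^ 2))) := by
  have hv0 := norm_nonneg v
  have hw0 := norm_nonneg w
  have hR : 0 ≤ R := hv0.trans hv
  -- the average equals `exp (-t² ‖w‖²) exp (-a) cosh b`
  set a := t ^ 2 * ‖v‖ ^ 2 with ha
  set b := 2 * t ^ 2 * inner ℝ v w with hb
  have e1 : (Real.exp (-(t ^ 2 * ‖v + w‖ ^ 2)) + Real.exp (-(t ^ 2 * ‖v - w‖ ^ 2))) / 2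
      = Real.exp (-(t ^ 2 * ‖w‖ ^ 2)) * (Real.exp (-a) * Real.cosh b) := by
    have i1 : -(t ^ 2 * ‖v + w‖ ^ 2) = -(t ^ 2 * ‖w‖ ^ 2) + -a + -b := by
      rw [norm_add_sq_real]; ring
    have i2 : -(t ^ 2 * ‖v - w‖ ^ 2) = -(t ^ 2 * ‖w‖ ^ 2) + -a + b := by
      rw [norm_sub_sq_real]; ring
    rw [Real.cosh_eq, i1, i2]
    simp only [Real.exp_add]; ring
  have hin : |inner ℝ v w| ≤ R * ‖w‖ :=
    (abs_real_inner_le_norm v w).trans (by gcongr)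
  have hb1 : |b| ≤ t ^ 2 * ‖w‖ ^ 2 / 2 + 2 * ξ ^ 2 * R ^ 2 := by
    have : |b| ≤ 2 * t ^ 2 * (R * ‖w‖) := by
      rw [hb, abs_mul, abs_of_nonneg (by positivity)]; gcongr
    have h2 : t ^ 2 * R ^ 2 ≤ ξ ^ 2 * R ^ 2 := by gcongr
    nlinarith [mul_nonneg (sq_nonneg t) (sq_nonneg (‖w‖ - 2 * R))]
  have hb2 : b ^ 2 ≤ 4 * t ^ 4 * (R ^ 2 * ‖w‖ ^ 2) := by
    have : inner ℝ v w ^ 2 ≤ (R * ‖w‖) ^ 2 := sq_le_sq' (by linarith [abs_le.1 hin]) (abs_le.1 hin).2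
    rw [hb]; nlinarith [pow_pos ht 4]
  have ha1 : a ≤ t ^ 2 * R ^ 2 := by rw [ha]; gcongr
  rw [e1, ← mul_sub_one, abs_mul, Real.abs_exp]
  set s := t ^ 2 * ‖w‖ ^ 2 with hs
  have hs0 : 0 ≤ s := by positivity
  have h3 : (t / 2) ^ 2 * ‖w‖ ^ 2 = s / 4 := by rw [hs]; ring
  rw [h3]
  calc Real.exp (-s) * |Real.exp (-a) * Real.cosh b - 1|
      ≤ Real.exp (-s) * ((t ^ 2 * R ^ 2 + 4 * t ^ 4 * (R ^ 2 * ‖w‖ ^ 2) / 2)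
          * Real.exp (s / 2 + 2 * ξ ^ 2 * R ^ 2)) := by
        gcongr
        refine (abs_exp_neg_mul_cosh_sub_one_le (by positivity) b).trans ?_
        gcongr
    _ = Real.exp (2 * ξ ^ 2 * R ^ 2) * R ^ 2 * t ^ 2 * Real.exp (-(s / 4))
          * (Real.exp (-(s / 4)) + 8 * (s / 4 * Real.exp (-(s / 4)))) := by
        have : Real.exp (-s) = Real.exp (-(s / 4)) * Real.exp (-(s / 4)) * Real.exp (-(s / 2)) := by
          rw [← Real.exp_add, ← Real.exp_add]; congr 1; ring
        have h4 : Real.exp (-(s / 2)) * Real.exp (s / 2) = 1 := by rw [← Real.exp_add]; simp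
        rw [this, Real.exp_add]
        have h5 : 4 * t ^ 4 * (R ^ 2 * ‖w‖ ^ 2) / 2 = 2 * t ^ 2 * R ^ 2 * s := by rw [hs]; ring
        rw [h5]
        linear_combination (Real.exp (-(s / 4)) * Real.exp (-(s / 4)) * (t ^ 2 * R ^ 2
          + 2 * t ^ 2 * R ^ 2 * s) * Real.exp (2 * ξ ^ 2 * R ^ 2)) * h4
    _ ≤ Real.exp (2 * ξ ^ 2 * R ^ 2) * R ^ 2 * t ^ 2 * Real.exp (-(s / 4)) * (1 + 8 * 1) := by
        gcongr
        · exact Real.exp_le_one_iff.2 (by linarith)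
        · exact mul_exp_neg_le_one _
    _ = _ := by ring

/-- The Gaussian kernel of width `1 / t`. -/
noncomputable def gaussKernel (t : ℝ) (v : Space) : ℝ := Real.exp (-(t ^ 2 * ‖v‖ ^ 2))

/-- Neutrality allows the term at `v = 0`, common to all particles, to be subtracted. -/
lemma abs_symAvg_gaussKernel_le {N : ℕ} {L R ξ t : ℝ} {q : Fin N → ℝ} (hq : ∑ n, q n = 0)
    (ht : 0 < t) (htξ : t ≤ ξ) {v : Fin N → Space} (hv : ∀ n, ‖v n‖ ≤ R) (p : ℤ × ℤ) :
    |symAvg (gaussKernel t) L q v p| ≤ (∑ n, |q n|) * (9 * R ^ 2 * Real.exp (2 * ξ ^ 2 * R ^ 2))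
      * (t ^ 2 * Real.exp (-((t / 2) ^ 2 * ‖shift L p‖ ^ 2))) := by
  have h : symAvg (gaussKernel t) L q v p
      = ∑ n, q n * ((gaussKernel t (v n + shift L p) + gaussKernel t (v n - shift L p)) / 2
        - gaussKernel t (shift L p)) := by
    simp only [mul_sub, Finset.sum_sub_distrib, ← Finset.sum_mul, hq, zero_mul, sub_zero, symAvg]
  rw [h, mul_assoc, Finset.sum_mul]
  refine (Finset.abs_sum_le_sum_abs _ _).trans (Finset.sum_le_sum fun n _ => ?_)
  rw [abs_mul]
  gcongr
  exact abs_gaussian_average_sub_le ht htξ (hv n) _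

/-- The Gaussian sum is of order `t⁻²`, with a Gaussian factor in the free direction and uniformly
in the plane. -/
lemma gaussSum_le {L t T : ℝ} (hL : 0 < L) (ht : 0 < t) (htT : t ≤ T) (v : Space) :
    gaussSum L t v ≤ Real.pi / L ^ 2 * (Real.exp (-(t ^ 2 * v 2 ^ 2)) / t ^ 2)
      * ∑' j : ℤ × ℤ, Real.exp (-(1 / (4 * T ^ 2) * ‖waveVec L j‖ ^ 2)) := by
  have hT : 0 < T := ht.trans_le htT
  have hπ := Real.pi_pos
  have h := congrArg norm (gaussSum_eq_tsum_waveVec hL ht v)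
  rw [norm_mul, Complex.norm_real, Complex.norm_real, Real.norm_eq_abs, Real.norm_eq_abs,
    abs_of_nonneg (by positivity : 0 ≤ Real.pi / L ^ 2 * (Real.exp (-(t ^ 2 * v 2 ^ 2)) / t ^ 2))] at h
  refine (le_abs_self _).trans (h.le.trans ?_)
  gcongr
  refine tsum_of_norm_bounded (summable_exp_neg_norm_waveVec hL (by positivity)).hasSum fun j => ?_
  rw [norm_mul, Complex.norm_exp_I_mul_ofReal, mul_one, Complex.norm_real, Real.norm_eq_abs,
    Real.abs_exp, one_div_mul_eq_div]
  gcongr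

lemma continuous_sq_mul_exp (c : ℝ) :
    Continuous fun t : ℝ => t ^ 2 * Real.exp (-((t / 2) ^ 2 * c)) := by fun_prop

/-- The integrals over `t` of the bounds for the averaged Gaussians are summable over the lattice,
since the Gaussian sum is of order `t⁻²`. -/
lemma summable_integral_sq_mul_exp {L ξ : ℝ} (hL : 0 < L) (hξ : 0 < ξ) :
    Summable fun p : ℤ × ℤ =>
      ∫ t in (0 : ℝ)..ξ, t ^ 2 * Real.exp (-((t / 2) ^ 2 * ‖shift L p‖ ^ 2)) := by
  set C := 4 * Real.pi / L ^ 2 * ∑' j : ℤ × ℤ, Real.exp (-(1 / (4 * (ξ / 2) ^ 2)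
    * ‖waveVec L j‖ ^ 2)) with hC
  refine summable_of_sum_le (c := ∫ t in (0 : ℝ)..ξ, C) (fun p =>
    intervalIntegral.integral_nonneg hξ.le fun t _ => by positivity) fun F => ?_
  rw [← intervalIntegral.integral_finsetSum fun p _ =>
    (continuous_sq_mul_exp _).intervalIntegrable _ _]
  refine intervalIntegral.integral_mono_on_of_le_Ioo hξ.le ?_ (by simp) fun t ht => ?_
  · exact (continuous_finsetSum _ fun p _ => continuous_sq_mul_exp _).intervalIntegrable _ _
  · rw [← Finset.mul_sum]
    have h1 := (summable_exp_neg_norm_add_shift hL (c := (t / 2) ^ 2)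
      (pow_pos (half_pos ht.1) 2) 0).sum_le_tsum F fun _ _ => (Real.exp_pos _).le
    have h2 := gaussSum_le hL (half_pos ht.1) (div_le_div_of_nonneg_right ht.2.le zero_le_two) 0
    simp only [zero_add] at h1
    rw [gaussSum] at h2
    simp only [zero_add, PiLp.zero_apply] at h2
    have ht0 := ht.1
    calc _ ≤ t ^ 2 * (Real.pi / L ^ 2 * (Real.exp (-((t / 2) ^ 2 * 0 ^ 2)) / (t / 2) ^ 2)
      * ∑' j : ℤ × ℤ, Real.exp (-(1 / (4 * (ξ / 2) ^ 2) * ‖waveVec L j‖ ^ 2))) := by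
          gcongr; exact h1.trans h2
      _ = C := by rw [hC]; simp; field_simp; norm_num

lemma eventually_le_norm_shift {L : ℝ} (hL : 0 < L) (r : ℝ) :
    ∀ᶠ p : ℤ × ℤ in cofinite, r ≤ ‖shift L p‖ := by
  have h := (summable_exp_neg_norm_shift hL one_pos).tendsto_cofinite_zero.eventually
    (gt_mem_nhds (Real.exp_pos (-(1 * r ^ 2))))
  filter_upwards [h] with p hp
  rw [Real.exp_lt_exp] at hp
  exact le_of_lt (lt_of_pow_lt_pow_left₀ 2 (norm_nonneg _) (by linarith))

lemma erfc_div_norm_le {ξ : ℝ} (hξ : 0 < ξ) {R : ℝ} {v w : Space} (hv : ‖v‖ ≤ R)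
    (hw : R + 1 ≤ ‖w‖) : erfc (ξ * ‖v + w‖) / ‖v + w‖
      ≤ Real.exp (ξ ^ 2 * R ^ 2) * Real.exp (-(ξ ^ 2 / 2 * ‖w‖ ^ 2)) := by
  have h1 : 1 ≤ ‖v + w‖ := by
    have : ‖w‖ ≤ ‖v + w‖ + ‖v‖ := by simpa using norm_sub_le (v + w) v
    linarith
  refine (div_le_self (erfc_nonneg _) h1).trans ((erfc_le_exp_neg_sq (by positivity)).trans ?_)
  rw [mul_pow]
  refine (exp_neg_norm_add_le (by positivity) v w).trans ?_
  gcongr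

lemma summable_erfc {L ξ : ℝ} (hL : 0 < L) (hξ : 0 < ξ) (v : Space) :
    Summable fun p : ℤ × ℤ => erfc (ξ * ‖v + shift L p‖) / ‖v + shift L p‖ := by
  refine Summable.of_norm_bounded_eventually ((summable_exp_neg_norm_shift hL
    (c := ξ ^ 2 / 2) (by positivity)).mul_left (Real.exp (ξ ^ 2 * ‖v‖ ^ 2))) ?_
  filter_upwards [eventually_le_norm_shift hL (‖v‖ + 1)] with p hp
  rw [Real.norm_eq_abs, abs_of_nonneg (div_nonneg (erfc_nonneg _) (norm_nonneg _))]
  exact erfc_div_norm_le hξ le_rfl hp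

lemma symAvg_gaussKernel_continuous {N : ℕ} (L : ℝ) (q : Fin N → ℝ) (v : Fin N → Space)
    (p : ℤ × ℤ) : Continuous fun t => symAvg (gaussKernel t) L q v p := by
  unfold symAvg gaussKernel; fun_prop

lemma symCell_eq {N : ℕ} (L ξ : ℝ) (q : Fin N → ℝ) (v : Fin N → Space) (p : ℤ × ℤ) :
    symCell L q v p = symAvg (fun w => erfc (ξ * ‖w‖) / ‖w‖) L q v p
      + 2 / √Real.pi * (∫ t in (0 : ℝ)..ξ, symAvg (gaussKernel t) L q v p)
      - symAvg (fun w => if w = 0 then 2 * ξ / √Real.pi else 0) L q v p := by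
  have hc : ∀ w : Space, Continuous fun t : ℝ => gaussKernel t w := fun w => by
    unfold gaussKernel; fun_prop
  simp only [symCell, symAvg]
  rw [intervalIntegral.integral_finsetSum fun n _ => by
    apply Continuous.intervalIntegrable
    exact (((hc _).add (hc _)).div_const 2).const_mul _]
  rw [Finset.mul_sum, ← Finset.sum_add_distrib, ← Finset.sum_sub_distrib]
  refine Finset.sum_congr rfl fun n _ => ?_
  rw [intervalIntegral.integral_const_mul, intervalIntegral.integral_div,
    intervalIntegral.integral_add ((hc _).intervalIntegrable _ _) ((hc _).intervalIntegrable _ _),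
    inv_norm_eq_erfc_add ξ (v n + shift L p), inv_norm_eq_erfc_add ξ (v n - shift L p)]
  simp only [gaussKernel]
  ring

lemma abs_integral_symAvg_gaussKernel_le {N : ℕ} {L R ξ : ℝ} (hξ : 0 < ξ) {q : Fin N → ℝ}
    (hq : ∑ n, q n = 0) {v : Fin N → Space} (hv : ∀ n, ‖v n‖ ≤ R) (p : ℤ × ℤ) :
    ∫ t in (0 : ℝ)..ξ, |symAvg (gaussKernel t) L q v p|
      ≤ (∑ n, |q n|) * (9 * R ^ 2 * Real.exp (2 * ξ ^ 2 * R ^ 2))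
      * ∫ t in (0 : ℝ)..ξ, t ^ 2 * Real.exp (-((t / 2) ^ 2 * ‖shift L p‖ ^ 2)) := by
  rw [← intervalIntegral.integral_const_mul]
  exact intervalIntegral.integral_mono_on_of_le_Ioo hξ.le
    ((symAvg_gaussKernel_continuous L q v p).abs.intervalIntegrable _ _)
    (((continuous_sq_mul_exp _).const_mul _).intervalIntegrable _ _)
    fun t ht => abs_symAvg_gaussKernel_le hq ht.1 ht.2.le hv p

/-- Outside a finite set of lattice vectors, the averaged Coulomb terms of a neutral system are
bounded by a summable sequence, uniformly for particles in a ball. -/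
lemma exists_symCell_bound {N : ℕ} {L : ℝ} (hL : 0 < L) {q : Fin N → ℝ} (hq : ∑ n, q n = 0)
    (R : ℝ) : ∃ (S : Finset (ℤ × ℤ)) (B : ℤ × ℤ → ℝ), Summable B ∧ ∀ p ∉ S,
      ∀ v : Fin N → Space, (∀ n, ‖v n‖ ≤ R) →
        (∀ n, v n + shift L p ≠ 0 ∧ v n - shift L p ≠ 0) ∧ |symCell L q v p| ≤ B p := by
  have hfin := eventually_le_norm_shift hL (R + 1)
  -- the splitting of the kernel with parameter `ξ = 1`
  refine ⟨(eventually_cofinite.1 hfin).toFinset, fun p =>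
    (∑ n, |q n|) * (Real.exp (1 ^ 2 * R ^ 2) * Real.exp (-(1 ^ 2 / 2 * ‖shift L p‖ ^ 2)))
    + 2 / √Real.pi * ((∑ n, |q n|) * (9 * R ^ 2 * Real.exp (2 * 1 ^ 2 * R ^ 2))
      * ∫ t in (0 : ℝ)..1, t ^ 2 * Real.exp (-((t / 2) ^ 2 * ‖shift L p‖ ^ 2))), ?_, ?_⟩
  · exact (((summable_exp_neg_norm_shift hL (by positivity)).mul_left _).mul_left _).add
      (((summable_integral_sq_mul_exp hL one_pos).mul_left _).mul_left _)
  · intro p hp v hv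
    simp only [Set.Finite.mem_toFinset, Set.mem_ofPred_eq, not_not] at hp
    have hne : ∀ n, v n + shift L p ≠ 0 ∧ v n - shift L p ≠ 0 := by
      intro n
      constructor
      · intro h
        have := norm_neg (v n)
        rw [← eq_neg_of_add_eq_zero_right h] at this
        linarith [hv n]
      · intro h
        have := hv n
        rw [sub_eq_zero.1 h] at this
        linarith
    refine ⟨hne, ?_⟩
    have h0 : symAvg (fun w : Space => if w = 0 then 2 * (1 : ℝ) / √Real.pi else 0) L q v p = 0 :=
      Finset.sum_eq_zero fun n _ => by simp [(hne n).1, (hne n).2]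
    rw [symCell_eq L 1, h0, sub_zero]
    refine (abs_add_le _ _).trans (add_le_add ?_ ?_)
    · rw [Finset.sum_mul]
      refine (Finset.abs_sum_le_sum_abs _ _).trans (Finset.sum_le_sum fun n _ => ?_)
      rw [abs_mul]
      gcongr
      have h1 := erfc_div_norm_le one_pos (hv n) hp
      have h2 := erfc_div_norm_le one_pos (hv n) (w := -shift L p) (by rwa [norm_neg])
      rw [norm_neg, ← sub_eq_add_neg] at h2
      rw [abs_of_nonneg (div_nonneg (add_nonneg (div_nonneg (erfc_nonneg _) (norm_nonneg _))
        (div_nonneg (erfc_nonneg _) (norm_nonneg _))) zero_le_two)]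
      linarith
    · rw [abs_mul, abs_of_nonneg (by positivity : 0 ≤ 2 / √Real.pi)]
      gcongr
      refine (intervalIntegral.abs_integral_le_integral_abs zero_le_one).trans ?_
      exact abs_integral_symAvg_gaussKernel_le one_pos hq hv p

lemma summable_ite_eq_zero {L : ℝ} (hL : 0 < L) (c : ℝ) (v : Space) :
    Summable fun p : ℤ × ℤ => if v + shift L p = 0 then c else 0 := by
  refine summable_of_hasFiniteSupport ((eventually_cofinite.1
    (eventually_le_norm_shift hL (‖v‖ + 1))).subset fun p hp => ?_)
  simp only [Function.mem_support, ne_eq, ite_eq_right_iff, not_forall] at hp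
  obtain ⟨h, -⟩ := hp
  rw [Set.mem_ofPred_eq, eq_neg_of_add_eq_zero_right h, norm_neg]
  linarith

/-- The symmetric Coulomb sum of a neutral system, as a short-range sum and an integral of Gaussian
lattice sums. The last sum is nonzero only if some `v n` is a lattice vector, where the Coulomb and
the short-range terms are zero by convention but the Gaussian is not. -/
theorem hasSum_symCell {N : ℕ} {L ξ : ℝ} (hL : 0 < L) (hξ : 0 < ξ) {q : Fin N → ℝ}
    (hq : ∑ n, q n = 0) (v : Fin N → Space) :
    HasSum (symCell L q v) (∑ n, q n * ∑' p, erfc (ξ * ‖v n + shift L p‖) / ‖v n + shift L p‖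
      + 2 / √Real.pi * (∫ t in (0 : ℝ)..ξ, ∑ n, q n * gaussSum L t (v n))
      - ∑ n, q n * ∑' p : ℤ × ℤ, if v n + shift L p = 0 then 2 * ξ / √Real.pi else 0) := by
  rw [funext (symCell_eq L ξ q v)]
  refine HasSum.sub (HasSum.add ?_ (HasSum.mul_left _ ?_)) ?_
  · exact hasSum_symAvg (f := fun w => erfc (ξ * ‖w‖) / ‖w‖) q fun n => summable_erfc hL hξ (v n)
  · obtain ⟨R, hR⟩ : ∃ R, ∀ n, ‖v n‖ ≤ R :=
      ⟨∑ n, ‖v n‖, fun n => Finset.single_le_sum (f := fun n => ‖v n‖)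
        (fun _ _ => norm_nonneg _) (Finset.mem_univ n)⟩
    have h := hasSum_integral_of_summable_integral_norm (μ := volume.restrict (Set.Ioc 0 ξ))
      (F := fun p t => symAvg (gaussKernel t) L q v p)
      (fun p => (symAvg_gaussKernel_continuous L q v p).integrableOn_Ioc) ?_
    · simp_rw [intervalIntegral.integral_of_le hξ.le]
      have e : Set.EqOn (fun t => ∑ n, q n * gaussSum L t (v n))
          (fun t => ∑' p, symAvg (gaussKernel t) L q v p) (Set.Ioc 0 ξ) := fun t ht =>
        (hasSum_symAvg (f := gaussKernel t) q fun n =>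
          summable_exp_neg_norm_add_shift hL (pow_pos ht.1 2) (v n)).tsum_eq.symm
      rw [setIntegral_congr_fun measurableSet_Ioc e]
      exact h
    · refine Summable.of_nonneg_of_le (fun p => integral_nonneg fun t => norm_nonneg _) (fun p => ?_)
        ((summable_integral_sq_mul_exp hL hξ).mul_left
          ((∑ n, |q n|) * (9 * R ^ 2 * Real.exp (2 * ξ ^ 2 * R ^ 2))))
      have := abs_integral_symAvg_gaussKernel_le (L := L) hξ hq hR p
      rwa [intervalIntegral.integral_of_le hξ.le] at this
  · exact hasSum_symAvg (f := fun w => if w = 0 then 2 * ξ / √Real.pi else 0) q fun n =>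
      summable_ite_eq_zero hL _ (v n)

/-! ### The k-space part -/

lemma tsum_eq_zero_add_tsum_ne {f : ℤ × ℤ → ℂ} (hf : Summable f) :
    ∑' j, f j = f 0 + ∑' j : {j : ℤ × ℤ // j ≠ 0}, f j := by
  rw [← hf.sum_add_tsum_subtype_compl {0}, Finset.sum_singleton]
  congr 1
  exact (Equiv.subtypeEquivRight fun j => by simp).tsum_eq
    (fun j : {j : ℤ × ℤ // j ≠ 0} => f j)

/-- The spectral gap of the lattice. -/
lemma le_norm_waveVec_sq {L : ℝ} {j : ℤ × ℤ} (hj : j ≠ 0) :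
    (2 * Real.pi / L) ^ 2 ≤ ‖waveVec L j‖ ^ 2 := by
  have h : (1 : ℝ) ≤ (j.1 : ℝ) ^ 2 + (j.2 : ℝ) ^ 2 := by
    have : 0 < j.1 ^ 2 + j.2 ^ 2 := by
      rcases ne_or_eq j.1 0 with h | h
      · positivity
      · have : j.2 ≠ 0 := fun h2 => hj (Prod.ext h h2)
        positivity
    exact_mod_cast this
  rw [norm_waveVec_sq, ← mul_add]
  exact le_mul_of_one_le_right (sq_nonneg _) h

lemma norm_waveVec_pos {L : ℝ} (hL : 0 < L) {j : ℤ × ℤ} (hj : j ≠ 0) : 0 < ‖waveVec L j‖ := by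
  have h : (0 : ℝ) < (2 * Real.pi / L) ^ 2 := by have := Real.pi_pos; positivity
  have := h.trans_le (le_norm_waveVec_sq hj)
  exact lt_of_pow_lt_pow_left₀ 2 (norm_nonneg _) (by simpa using this)

/-- The plane wave with index `j`. -/
noncomputable def planeWave (L : ℝ) (j : ℤ × ℤ) (v : Space) : ℂ :=
  Complex.exp (Complex.I * (inner ℝ (waveVec L j) (planar v) : ℝ))

lemma norm_planeWave (L : ℝ) (j : ℤ × ℤ) (v : Space) : ‖planeWave L j v‖ = 1 :=
  Complex.norm_exp_I_mul_ofReal _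

/-- The k-space sum over the nonzero wave vectors for one pair of particles, up to a constant. -/
noncomputable def waveSum (L ξ : ℝ) (v : Space) : ℂ :=
  ∑' j : {j : ℤ × ℤ // j ≠ 0}, planeWave L j v * (widthIntegral ξ ‖waveVec L j‖ (v 2) : ℝ)

lemma widthIntegrand_le_exp {L ξ : ℝ} (hL : 0 < L) {j : ℤ × ℤ} (hj : j ≠ 0) (z : ℝ) {t : ℝ}
    (ht : 0 < t) (htξ : t ≤ ξ) :
    Real.exp (-(‖waveVec L j‖ ^ 2 / (4 * t ^ 2))) * (Real.exp (-(t ^ 2 * z ^ 2)) / t ^ 2)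
      ≤ 8 / (2 * Real.pi / L) ^ 2 * Real.exp (-(1 / (8 * ξ ^ 2) * ‖waveVec L j‖ ^ 2)) := by
  have hπ := Real.pi_pos
  refine (widthIntegrand_le (by positivity) (le_norm_waveVec_sq hj) z ht htξ).trans ?_
  refine mul_le_of_le_one_right (by positivity) (Real.exp_le_one_iff.2 ?_)
  nlinarith [mul_nonneg (sq_nonneg t) (sq_nonneg z)]

lemma widthIntegral_nonneg {ξ : ℝ} (hξ : 0 ≤ ξ) (k z : ℝ) : 0 ≤ widthIntegral ξ k z :=
  intervalIntegral.integral_nonneg hξ fun t _ => by positivity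

lemma widthIntegral_le_exp {L ξ : ℝ} (hL : 0 < L) (hξ : 0 < ξ) {j : ℤ × ℤ} (hj : j ≠ 0) (z : ℝ) :
    widthIntegral ξ ‖waveVec L j‖ z
      ≤ ξ * (8 / (2 * Real.pi / L) ^ 2) * Real.exp (-(1 / (8 * ξ ^ 2) * ‖waveVec L j‖ ^ 2)) := by
  have := intervalIntegral.integral_mono_on_of_le_Ioo hξ.le
    (intervalIntegrable_widthIntegrand hξ.le (norm_waveVec_pos hL hj).ne' z)
    (intervalIntegrable_const (c := 8 / (2 * Real.pi / L) ^ 2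
      * Real.exp (-(1 / (8 * ξ ^ 2) * ‖waveVec L j‖ ^ 2))))
    fun t ht => widthIntegrand_le_exp hL hj z ht.1 ht.2.le
  rw [intervalIntegral.integral_const] at this
  refine this.trans (le_of_eq ?_)
  simp only [smul_eq_mul, sub_zero]; ring

lemma summable_exp_neg_norm_waveVec_ne {L c : ℝ} (hL : 0 < L) (hc : 0 < c) :
    Summable fun j : {j : ℤ × ℤ // j ≠ 0} => Real.exp (-(c * ‖waveVec L j‖ ^ 2)) :=
  (summable_exp_neg_norm_waveVec hL hc).subtype _

lemma summable_planeWave_mul_widthIntegral {L ξ : ℝ} (hL : 0 < L) (hξ : 0 < ξ) (v : Space) :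
    Summable fun j : {j : ℤ × ℤ // j ≠ 0} =>
      planeWave L j v * (widthIntegral ξ ‖waveVec L j‖ (v 2) : ℝ) := by
  refine Summable.of_norm_bounded ((summable_exp_neg_norm_waveVec_ne hL
    (c := 1 / (8 * ξ ^ 2)) (by positivity)).mul_left (ξ * (8 / (2 * Real.pi / L) ^ 2)))
    fun j => ?_
  rw [norm_mul, norm_planeWave, one_mul, Complex.norm_real, Real.norm_eq_abs,
    abs_of_nonneg (widthIntegral_nonneg hξ.le _ _)]
  exact widthIntegral_le_exp hL hξ j.2 _

/-- The modes `j ≠ 0` of a Gaussian lattice sum, integrated over the width. -/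
lemma integral_modes {L ξ : ℝ} (hL : 0 < L) (hξ : 0 < ξ) (v : Space) :
    Integrable (fun t : ℝ => ∑' j : {j : ℤ × ℤ // j ≠ 0}, planeWave L j v
      * (Real.exp (-(‖waveVec L j‖ ^ 2 / (4 * t ^ 2))) * (Real.exp (-(t ^ 2 * v 2 ^ 2)) / t ^ 2) : ℝ))
      (volume.restrict (Set.Ioc 0 ξ)) ∧
    ∫ t in Set.Ioc 0 ξ, ∑' j : {j : ℤ × ℤ // j ≠ 0}, planeWave L j v
      * (Real.exp (-(‖waveVec L j‖ ^ 2 / (4 * t ^ 2))) * (Real.exp (-(t ^ 2 * v 2 ^ 2)) / t ^ 2) : ℝ)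
      = waveSum L ξ v := by
  set B : {j : ℤ × ℤ // j ≠ 0} → ℝ := fun j => 8 / (2 * Real.pi / L) ^ 2
    * Real.exp (-(1 / (8 * ξ ^ 2) * ‖waveVec L j‖ ^ 2)) with hB
  have hBs : Summable B := (summable_exp_neg_norm_waveVec_ne hL (by positivity)).mul_left _
  set F : {j : ℤ × ℤ // j ≠ 0} → ℝ → ℂ := fun j t => planeWave L j v
      * (Real.exp (-(‖waveVec L j‖ ^ 2 / (4 * t ^ 2))) * (Real.exp (-(t ^ 2 * v 2 ^ 2)) / t ^ 2) : ℝ)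
    with hF
  have hm : ∀ j, Measurable (F j) := fun j =>
    (Complex.measurable_ofReal.comp (measurable_widthIntegrand _ _)).const_mul _
  have hb : ∀ j, ∀ t ∈ Set.Ioc 0 ξ, ‖F j t‖ ≤ B j := by
    intro j t ht
    rw [norm_mul, norm_planeWave, one_mul, Complex.norm_real, Real.norm_eq_abs,
      abs_of_nonneg (by have := ht.1; positivity)]
    exact widthIntegrand_le_exp hL j.2 _ ht.1 ht.2
  have hFi : ∀ j, Integrable (F j) (volume.restrict (Set.Ioc 0 ξ)) := fun j =>
    Measure.integrableOn_of_bounded (M := B j) (by simp) (hm j).aestronglyMeasurable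
      ((ae_restrict_iff' measurableSet_Ioc).2 (Eventually.of_forall (hb j)))
  have hsum := hasSum_integral_of_summable_integral_norm hFi (by
    refine Summable.of_nonneg_of_le (fun j => integral_nonneg fun _ => norm_nonneg _) (fun j => ?_)
      (hBs.mul_left ξ)
    have := setIntegral_mono_on (hFi j).norm (integrable_const (B j)) measurableSet_Ioc (hb j)
    refine this.trans (le_of_eq ?_)
    simp [hξ.le])
  refine ⟨?_, ?_⟩
  · refine Measure.integrableOn_of_bounded (M := ∑' j, B j) (by simp)
      (Measurable.tsum hm).aestronglyMeasurable
      ((ae_restrict_iff' measurableSet_Ioc).2 (Eventually.of_forall fun t ht => ?_))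
    exact tsum_of_norm_bounded hBs.hasSum fun j => hb j t ht
  · rw [waveSum, ← hsum.tsum_eq]
    congr 1; ext j
    rw [hF, integral_const_mul, integral_complex_ofReal, widthIntegral,
      intervalIntegral.integral_of_le hξ.le]

/-- The contribution of the wave vector zero for one pair of particles, up to a constant. -/
noncomputable def zeroMode (ξ z : ℝ) : ℝ :=
  Real.exp (-(ξ ^ 2 * z ^ 2)) / ξ + √Real.pi * z * erf (ξ * z)

/-- The long-range part of the Ewald splitting in terms of its Fourier modes. Neutrality makes the
mode zero integrable. -/
theorem integral_gaussSum {N : ℕ} {L ξ : ℝ} (hL : 0 < L) (hξ : 0 < ξ) {q : Fin N → ℝ}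
    (hq : ∑ n, q n = 0) (v : Fin N → Space) :
    ((2 / √Real.pi * ∫ t in (0 : ℝ)..ξ, ∑ n, q n * gaussSum L t (v n) : ℝ) : ℂ)
      = (2 * √Real.pi / L ^ 2 : ℝ) * (∑ n, (q n : ℂ) * waveSum L ξ (v n)
        - (∑ n, q n * zeroMode ξ (v n 2) : ℝ)) := by
  have hπ := Real.pi_pos
  have hz := fun n => integral_exp_neg_sub_one_div_sq hξ (v n 2)
  have hm := fun n => integral_modes hL hξ (v n)
  -- by neutrality `-1` may be added to the mode zero of each particle
  have hEq : Set.EqOn (fun t : ℝ => ((∑ n, q n * gaussSum L t (v n) : ℝ) : ℂ))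
      (fun t => (Real.pi / L ^ 2 : ℝ) * ∑ n, ((q n : ℂ)
        * ((((Real.exp (-(t ^ 2 * v n 2 ^ 2)) - 1) / t ^ 2 : ℝ) : ℂ)
          + ∑' j : {j : ℤ × ℤ // j ≠ 0}, planeWave L j (v n)
          * (Real.exp (-(‖waveVec L j‖ ^ 2 / (4 * t ^ 2)))
            * (Real.exp (-(t ^ 2 * v n 2 ^ 2)) / t ^ 2) : ℝ)))) (Set.Ioc 0 ξ) := by
    intro t ht
    have ht0 := ht.1
    have h1 : ∀ n, (gaussSum L t (v n) : ℂ) = (Real.pi / L ^ 2 : ℝ)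
        * ((((Real.exp (-(t ^ 2 * v n 2 ^ 2)) - 1) / t ^ 2 : ℝ) : ℂ)
          + ∑' j : {j : ℤ × ℤ // j ≠ 0}, planeWave L j (v n)
          * (Real.exp (-(‖waveVec L j‖ ^ 2 / (4 * t ^ 2)))
            * (Real.exp (-(t ^ 2 * v n 2 ^ 2)) / t ^ 2) : ℝ)) + (Real.pi / L ^ 2 / t ^ 2 : ℝ) := by
      intro n
      rw [gaussSum_eq_tsum_waveVec hL ht0, tsum_eq_zero_add_tsum_ne]
      · have e0 : waveVec L 0 = 0 := by ext i; fin_cases i <;> simp [waveVec]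
        have e1 : ∀ j : {j : ℤ × ℤ // j ≠ 0}, planeWave L j (v n)
          * (Real.exp (-(‖waveVec L j‖ ^ 2 / (4 * t ^ 2)))
            * (Real.exp (-(t ^ 2 * v n 2 ^ 2)) / t ^ 2) : ℝ)
            = ((Real.exp (-(t ^ 2 * v n 2 ^ 2)) / t ^ 2 : ℝ) : ℂ)
              * ((Real.exp (-(‖waveVec L j‖ ^ 2 / (4 * t ^ 2))) : ℂ)
          * Complex.exp (Complex.I * (inner ℝ (waveVec L j) (planar (v n)) : ℝ))) := by
          intro j; rw [planeWave]; push_cast; ring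
        simp_rw [e1]
        rw [tsum_mul_left, e0]
        simp only [norm_zero, inner_zero_left]
        push_cast
        simp
        ring
      · refine Summable.of_norm_bounded (summable_exp_neg_norm_waveVec hL
          (c := 1 / (4 * t ^ 2)) (by positivity)) fun j => ?_
        rw [norm_mul, Complex.norm_exp_I_mul_ofReal, mul_one, Complex.norm_real, Real.norm_eq_abs,
          Real.abs_exp, one_div_mul_eq_div]
    have hq' : ∑ n, (q n : ℂ) = 0 := by exact_mod_cast hq
    simp only [Complex.ofReal_sum, Complex.ofReal_mul, h1, mul_add (q _ : ℂ),
      Finset.sum_add_distrib, ← Finset.sum_mul, hq', zero_mul, add_zero]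
    simp only [Finset.mul_sum, ← Finset.sum_add_distrib]
    refine Finset.sum_congr rfl fun n _ => ?_
    ring
  have hzi : ∀ n, Integrable (fun t : ℝ => (((Real.exp (-(t ^ 2 * v n 2 ^ 2)) - 1) / t ^ 2 : ℝ) : ℂ))
      (volume.restrict (Set.Ioc 0 ξ)) := fun n =>
    ((intervalIntegrable_iff_integrableOn_Ioc_of_le hξ.le).1 (hz n).1).ofReal
  rw [intervalIntegral.integral_of_le hξ.le, Complex.ofReal_mul, ← integral_complex_ofReal,
    setIntegral_congr_fun measurableSet_Ioc hEq, integral_const_mul, integral_finsetSum]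
  swap
  · exact fun n _ => ((hzi n).add (hm n).1).const_mul _
  have h2 : ∀ n, ∫ t in Set.Ioc 0 ξ, ((q n : ℂ)
        * ((((Real.exp (-(t ^ 2 * v n 2 ^ 2)) - 1) / t ^ 2 : ℝ) : ℂ)
          + ∑' j : {j : ℤ × ℤ // j ≠ 0}, planeWave L j (v n)
          * (Real.exp (-(‖waveVec L j‖ ^ 2 / (4 * t ^ 2)))
            * (Real.exp (-(t ^ 2 * v n 2 ^ 2)) / t ^ 2) : ℝ)))
      = (q n : ℂ) * waveSum L ξ (v n) - (q n * zeroMode ξ (v n 2) : ℝ) + (q n : ℂ) * (1 / ξ : ℝ) := by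
    intro n
    rw [integral_const_mul, integral_add (hzi n) (hm n).1, (hm n).2, integral_complex_ofReal,
      ← intervalIntegral.integral_of_le hξ.le, (hz n).2, zeroMode]
    push_cast; ring
  have hq' : ∑ n, (q n : ℂ) = 0 := by exact_mod_cast hq
  simp only [h2, Finset.sum_add_distrib, Finset.sum_sub_distrib, ← Finset.sum_mul, hq', zero_mul,
    add_zero, ← Complex.ofReal_sum]
  rw [← mul_assoc, ← Complex.ofReal_mul]
  congr 2
  have := Real.mul_self_sqrt hπ.le
  field_simp
  nlinarith

lemma closedTerm_eq {N : ℕ} {L ξ : ℝ} (hL : 0 < L) (hξ : 0 < ξ) (q : Fin N → ℝ)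
    (x : Fin N → Space) (m n : Fin N) {j : ℤ × ℤ} (hj : j ≠ 0) :
    closedTerm ξ q x m n (waveVec L j) = (2 / √Real.pi : ℝ) * (q n : ℂ)
      * (planeWave L j (x m - x n) * (widthIntegral ξ ‖waveVec L j‖ ((x m - x n) 2) : ℝ)) := by
  have hk := norm_waveVec_pos hL hj
  have hπ : (√Real.pi : ℂ) ≠ 0 := by exact_mod_cast (Real.sqrt_pos.2 Real.pi_pos).ne'
  have hk' : (‖waveVec L j‖ : ℂ) ≠ 0 := by exact_mod_cast hk.ne'
  rw [widthIntegral_eq hξ hk, closedTerm, planeWave, PiLp.sub_apply]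
  push_cast
  field_simp

lemma integral_exp_neg_div_sq {A ξ : ℝ} (hA : 0 < A) (hξ : 0 < ξ) :
    ∫ t in (0 : ℝ)..ξ, Real.exp (-A / (4 * t ^ 2)) / (2 * t ^ 3) = Real.exp (-A / (4 * ξ ^ 2)) / A := by
  have hd : ∀ t : ℝ, 0 < t → HasDerivAt (fun t : ℝ => Real.exp (-A / (4 * t ^ 2)) / A)
      (Real.exp (-A / (4 * t ^ 2)) / (2 * t ^ 3)) t := by
    intro t ht
    have h1 := ((hasDerivAt_pow 2 t).const_mul 4).inv (by positivity)
    have h2 := ((h1.const_mul (-A)).exp).div_const A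
    refine h2.congr_deriv ?_
    have e : -A * (fun y : ℝ => 4 * y ^ 2)⁻¹ t = -A / (4 * t ^ 2) := rfl
    rw [e]
    field_simp
    norm_num
    ring
  have h0 : Tendsto (fun t : ℝ => Real.exp (-A / (4 * t ^ 2)) / A) (𝓝[>] 0) (𝓝 0) := by
    have h1 : Tendsto (fun t : ℝ => 4 * t ^ 2) (𝓝[>] 0) (𝓝[>] 0) := by
      refine tendsto_nhdsWithin_of_tendsto_nhds_of_eventually_within _ ?_ ?_
      · have : Tendsto (fun t : ℝ => 4 * t ^ 2) (𝓝 0) (𝓝 (4 * 0 ^ 2)) :=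
          Continuous.tendsto (by fun_prop) 0
        simpa using this.mono_left nhdsWithin_le_nhds
      · filter_upwards [self_mem_nhdsWithin] with t ht
        have : 0 < t := ht
        show 0 < 4 * t ^ 2
        positivity
    have h2 := (tendsto_inv_nhdsGT_zero.comp h1).const_mul_atTop_of_neg (neg_lt_zero.2 hA)
    simpa [div_eq_mul_inv] using (Real.tendsto_exp_atBot.comp h2).div_const A
  have h1 := (hd ξ hξ).continuousAt.tendsto.mono_left (nhdsWithin_le_nhds (s := Set.Iio ξ))
  rw [intervalIntegral.integral_eq_sub_of_hasDerivAt_of_tendsto hξ (fun t ht => hd t ht.1) ?_ h0 h1,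
    sub_zero]
  refine intervalIntegrable_of_bound (C := 16 * ξ / A ^ 2 * 2) hξ.le (by fun_prop) fun t ht htξ => ?_
  rw [abs_of_nonneg (by positivity)]
  have e1 : Real.exp (-A / (4 * t ^ 2)) = Real.exp (-(A / (8 * t ^ 2))) ^ 2 := by
    rw [← Real.exp_nat_mul]; congr 1; field_simp; norm_num
  have e2 : A / (8 * t ^ 2) * Real.exp (-(A / (8 * t ^ 2))) ≤ 1 := mul_exp_neg_le_one _
  set y := Real.exp (-(A / (8 * t ^ 2)))
  have e3 : (A / (8 * t ^ 2) * y) ^ 2 ≤ 1 := pow_le_one₀ (by positivity) e2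
  rw [e1]
  calc y ^ 2 / (2 * t ^ 3) = 32 * t / A ^ 2 * (A / (8 * t ^ 2) * y) ^ 2 := by field_simp; ring
    _ ≤ 32 * t / A ^ 2 * 1 := by gcongr
    _ ≤ 16 * ξ / A ^ 2 * 2 := by rw [mul_one, div_mul_eq_mul_div]; gcongr 1; linarith

lemma integral_gaussian_mul_exp_I {t : ℝ} (ht : 0 < t) (z : ℝ) :
    ∫ κ : ℝ, (Real.exp (-κ ^ 2 / (4 * t ^ 2)) : ℂ) * Complex.exp (Complex.I * (κ * z : ℝ))
      = (2 * t * √Real.pi * Real.exp (-(t ^ 2 * z ^ 2)) : ℝ) := by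
  have h := fourierIntegral_gaussian (b := ((1 / (4 * t ^ 2) : ℝ) : ℂ))
    (by rw [Complex.ofReal_re]; positivity) z
  have e1 : ((Real.pi : ℂ) / ((1 / (4 * t ^ 2) : ℝ) : ℂ)) ^ (1 / 2 : ℂ) = (2 * t * √Real.pi : ℝ) := by
    have : (Real.pi : ℂ) / ((1 / (4 * t ^ 2) : ℝ) : ℂ) = ((Real.pi * (2 * t) ^ 2 : ℝ) : ℂ) := by
      push_cast; field_simp; ring
    have h2 := Complex.ofReal_cpow (x := Real.pi * (2 * t) ^ 2)
      (by have := Real.pi_pos; positivity) (1 / 2)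
    rw [this]
    push_cast at h2 ⊢
    rw [← h2, ← Complex.ofReal_ofNat, ← Complex.ofReal_mul, ← Complex.ofReal_mul,
      ← Real.sqrt_eq_rpow, Real.sqrt_mul Real.pi_pos.le, Real.sqrt_sq (by positivity)]
    push_cast; ring
  rw [e1] at h
  rw [Complex.ofReal_mul, Complex.ofReal_exp]
  have ht' : (t : ℂ) ≠ 0 := by exact_mod_cast ht.ne'
  convert h using 1
  · congr 1; ext κ
    rw [mul_comm]
    push_cast
    congr 2
    · ring
    · field_simp
  · congr 2
    push_cast
    field_simp

lemma integrable_exp_neg_sq_div {ξ : ℝ} (hξ : 0 < ξ) :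
    Integrable fun κ : ℝ => Real.exp (-κ ^ 2 / (4 * ξ ^ 2)) := by
  refine (integrable_exp_neg_mul_sq (b := 1 / (4 * ξ ^ 2)) (by positivity)).congr
    (Eventually.of_forall fun κ => ?_)
  simp only
  congr 1; ring

lemma integrable_fourierKernel {k ξ : ℝ} (hk : 0 < k) (hξ : 0 < ξ) :
    Integrable fun κ : ℝ => Real.exp (-(k ^ 2 + κ ^ 2) / (4 * ξ ^ 2)) / (k ^ 2 + κ ^ 2) := by
  refine ((integrable_exp_neg_sq_div hξ).div_const (k ^ 2)).mono'
    (Measurable.aestronglyMeasurable (by fun_prop)) (Eventually.of_forall fun κ => ?_)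
  rw [Real.norm_eq_abs, abs_of_nonneg (by positivity)]
  gcongr <;> nlinarith [sq_nonneg k, sq_nonneg κ]

/-- The Fourier integral in the free direction: writing the kernel as an integral over the Gaussian
width reduces it to Gaussian Fourier integrals. -/
lemma integral_fourierKernel {k ξ : ℝ} (hk : 0 < k) (hξ : 0 < ξ) (z : ℝ) :
    ∫ κ : ℝ, ((Real.exp (-(k ^ 2 + κ ^ 2) / (4 * ξ ^ 2)) / (k ^ 2 + κ ^ 2) : ℝ) : ℂ)
      * Complex.exp (Complex.I * (κ * z : ℝ)) = (√Real.pi * widthIntegral ξ k z : ℝ) := by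
  set g : ℝ → ℝ → ℂ := fun κ t =>
    ((Real.exp (-(k ^ 2 + κ ^ 2) / (4 * t ^ 2)) / (2 * t ^ 3) : ℝ) : ℂ)
      * Complex.exp (Complex.I * (κ * z : ℝ)) with hg
  have e1 : ∀ κ : ℝ, ((Real.exp (-(k ^ 2 + κ ^ 2) / (4 * ξ ^ 2)) / (k ^ 2 + κ ^ 2) : ℝ) : ℂ)
      * Complex.exp (Complex.I * (κ * z : ℝ)) = ∫ t in Set.Ioc 0 ξ, g κ t := by
    intro κ
    rw [hg, integral_mul_const, integral_complex_ofReal, ← intervalIntegral.integral_of_le hξ.le,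
      integral_exp_neg_div_sq (by positivity) hξ]
  have hint : Integrable (Function.uncurry g) (volume.prod (volume.restrict (Set.Ioc 0 ξ))) := by
    have hb : Integrable (fun p : ℝ × ℝ => Real.exp (-p.1 ^ 2 / (4 * ξ ^ 2))
        * (32 * ξ / (k ^ 2) ^ 2)) (volume.prod (volume.restrict (Set.Ioc 0 ξ))) :=
      (integrable_exp_neg_sq_div hξ).mul_prod
        (integrable_const (μ := volume.restrict (Set.Ioc 0 ξ)) (32 * ξ / (k ^ 2) ^ 2))
    refine hb.mono' (Measurable.aestronglyMeasurable ?_) ?_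
    · unfold Function.uncurry
      exact (Complex.measurable_ofReal.comp (by fun_prop)).mul
        (Complex.measurable_exp.comp ((Complex.measurable_ofReal.comp (by fun_prop)).const_mul _))
    · have : ∀ᵐ t ∂(volume.restrict (Set.Ioc 0 ξ)), t ∈ Set.Ioc 0 ξ :=
        ae_restrict_mem measurableSet_Ioc
      filter_upwards [Measure.quasiMeasurePreserving_snd.ae this] with p hp
      obtain ⟨κ, t⟩ := p
      have ht : 0 < t := hp.1
      have htξ : t ≤ ξ := hp.2
      simp only [Function.uncurry, hg]
      rw [norm_mul, Complex.norm_exp_I_mul_ofReal, mul_one, Complex.norm_real, Real.norm_eq_abs,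
        abs_of_nonneg (by positivity)]
      have s1 : Real.exp (-(k ^ 2 + κ ^ 2) / (4 * t ^ 2))
          = Real.exp (-κ ^ 2 / (4 * t ^ 2)) * Real.exp (-(k ^ 2 / (8 * t ^ 2))) ^ 2 := by
        rw [sq (Real.exp _), ← Real.exp_add, ← Real.exp_add]; congr 1; field_simp; ring
      have s2 : Real.exp (-κ ^ 2 / (4 * t ^ 2)) ≤ Real.exp (-κ ^ 2 / (4 * ξ ^ 2)) := by
        apply Real.exp_le_exp.2
        rw [neg_div, neg_div, neg_le_neg_iff]
        gcongr
      have s3 : k ^ 2 / (8 * t ^ 2) * Real.exp (-(k ^ 2 / (8 * t ^ 2))) ≤ 1 := mul_exp_neg_le_one _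
      rw [s1]
      set y := Real.exp (-(k ^ 2 / (8 * t ^ 2)))
      have s4 : (k ^ 2 / (8 * t ^ 2) * y) ^ 2 ≤ 1 := pow_le_one₀ (by positivity) s3
      calc Real.exp (-κ ^ 2 / (4 * t ^ 2)) * y ^ 2 / (2 * t ^ 3)
          = Real.exp (-κ ^ 2 / (4 * t ^ 2)) * (32 * t / (k ^ 2) ^ 2
            * (k ^ 2 / (8 * t ^ 2) * y) ^ 2) := by field_simp; ring
        _ ≤ Real.exp (-κ ^ 2 / (4 * ξ ^ 2)) * (32 * ξ / (k ^ 2) ^ 2 * 1) := by gcongr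
        _ = _ := by rw [mul_one]
  simp_rw [e1]
  rw [integral_integral_swap hint]
  have e2 : Set.EqOn (fun t => ∫ κ, g κ t) (fun t => ((√Real.pi * (Real.exp (-(k ^ 2 / (4 * t ^ 2)))
      * (Real.exp (-(t ^ 2 * z ^ 2)) / t ^ 2)) : ℝ) : ℂ)) (Set.Ioc 0 ξ) := by
    intro t ht
    have ht0 := ht.1
    have : ∀ κ, g κ t = ((Real.exp (-(k ^ 2 / (4 * t ^ 2))) / (2 * t ^ 3) : ℝ) : ℂ)
        * ((Real.exp (-κ ^ 2 / (4 * t ^ 2)) : ℂ) * Complex.exp (Complex.I * (κ * z : ℝ))) := by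
      intro κ
      rw [hg, ← mul_assoc, ← Complex.ofReal_mul]
      rw [div_mul_eq_mul_div, ← Real.exp_add]
      ring_nf
    simp only [this]
    rw [integral_const_mul, integral_gaussian_mul_exp_I ht0, ← Complex.ofReal_mul]
    congr 1
    field_simp
  rw [setIntegral_congr_fun measurableSet_Ioc e2, integral_complex_ofReal, integral_const_mul,
    widthIntegral, intervalIntegral.integral_of_le hξ.le]

lemma fourierIntegrand_eq {N : ℕ} (ξ : ℝ) (q : Fin N → ℝ) (x : Fin N → Space) (m n : Fin N)
    (L : ℝ) (j : ℤ × ℤ) (κ : ℝ) : fourierIntegrand ξ q x m n (waveVec L j) κ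
      = ((q n : ℂ) * planeWave L j (x m - x n))
        * (((Real.exp (-(‖waveVec L j‖ ^ 2 + κ ^ 2) / (4 * ξ ^ 2))
          / (‖waveVec L j‖ ^ 2 + κ ^ 2) : ℝ) : ℂ)
          * Complex.exp (Complex.I * (κ * (x m - x n) 2 : ℝ))) := by
  rw [fourierIntegrand, planeWave, PiLp.sub_apply]; ring

lemma integrable_fourierIntegrand {N : ℕ} {L ξ : ℝ} (hL : 0 < L) (hξ : 0 < ξ) (q : Fin N → ℝ)
    (x : Fin N → Space) (m n : Fin N) {j : ℤ × ℤ} (hj : j ≠ 0) :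
    Integrable (fourierIntegrand ξ q x m n (waveVec L j)) volume := by
  rw [funext (fourierIntegrand_eq ξ q x m n L j)]
  refine Integrable.const_mul ?_ _
  refine (integrable_fourierKernel (norm_waveVec_pos hL hj) hξ).ofReal.mul_bdd (c := 1)
    (Continuous.aestronglyMeasurable (by fun_prop)) (Eventually.of_forall fun κ => ?_)
  rw [Complex.norm_exp_I_mul_ofReal]

lemma integral_fourierIntegrand {N : ℕ} {L ξ : ℝ} (hL : 0 < L) (hξ : 0 < ξ) (q : Fin N → ℝ)
    (x : Fin N → Space) (m n : Fin N) {j : ℤ × ℤ} (hj : j ≠ 0) :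
    ∫ κ : ℝ, fourierIntegrand ξ q x m n (waveVec L j) κ = (√Real.pi : ℝ) * (q n : ℂ)
      * (planeWave L j (x m - x n) * (widthIntegral ξ ‖waveVec L j‖ ((x m - x n) 2) : ℝ)) := by
  simp only [fourierIntegrand_eq ξ q x m n L j]
  rw [integral_const_mul, integral_fourierKernel (norm_waveVec_pos hL hj) hξ]
  push_cast; ring

/-! ### The fundamental solution of the Laplacian -/

/-- The second derivative of `f` at `y` in the coordinate direction `i`. -/
noncomputable def secondDeriv (i : Fin 3) (f : Space → ℝ) (y : Space) : ℝ :=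
  fderiv ℝ (fun z => fderiv ℝ f z (EuclideanSpace.single i 1)) y (EuclideanSpace.single i 1)

lemma laplacian_eq_sum_secondDeriv {f : Space → ℝ} (hf : ContDiff ℝ 2 f) (y : Space) :
    Δ f y = ∑ i, secondDeriv i f y := by
  rw [InnerProductSpace.laplacian_eq_iteratedFDeriv_orthonormalBasis f
    (EuclideanSpace.basisFun (Fin 3) ℝ)]
  refine Finset.sum_congr rfl fun i _ => ?_
  have hd : DifferentiableAt ℝ (fderiv ℝ f) y :=
    (hf.fderiv_right (m := 1) (by norm_num)).differentiable one_ne_zero y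
  rw [iteratedFDeriv_two_apply, secondDeriv, fderiv_clm_apply hd (differentiableAt_const _)]
  simp

lemma contDiff_fderiv_apply {f : Space → ℝ} {n m : WithTop ℕ∞} (hf : ContDiff ℝ n f)
    (hm : m + 1 ≤ n) (v : Space) : ContDiff ℝ m fun z => fderiv ℝ f z v :=
  (hf.fderiv_right hm).clm_apply contDiff_const

lemma continuous_secondDeriv {f : Space → ℝ} (hf : ContDiff ℝ 2 f) (i : Fin 3) :
    Continuous (secondDeriv i f) :=
  (contDiff_fderiv_apply (m := 0) (contDiff_fderiv_apply (m := 1) hf (by norm_num) _)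
    (by norm_num) _).continuous

lemma integral_mul_secondDeriv {g ψ : Space → ℝ} (hg : ContDiff ℝ 2 g) (hψ : ContDiff ℝ 2 ψ)
    (hc : HasCompactSupport ψ) (i : Fin 3) :
    ∫ y, g y * secondDeriv i ψ y = ∫ y, secondDeriv i g y * ψ y := by
  set e : Space := EuclideanSpace.single i 1
  have hg1 := contDiff_fderiv_apply (m := 1) hg (by norm_num) e
  have hψ1 := contDiff_fderiv_apply (m := 1) hψ (by norm_num) e
  have hc1 : HasCompactSupport fun z => fderiv ℝ ψ z e := hc.fderiv_apply ℝ e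
  have hg2 := continuous_secondDeriv hg i
  have hψ2 := continuous_secondDeriv hψ i
  have hc2 : HasCompactSupport (secondDeriv i ψ) := hc1.fderiv_apply ℝ e
  have h1 := integral_mul_fderiv_eq_neg_fderiv_mul_of_integrable (μ := (volume : Measure Space))
    (f := g) (g := fun z => fderiv ℝ ψ z e) (v := e)
    ((hg1.continuous.mul hψ1.continuous).integrable_of_hasCompactSupport hc1.mul_left)
    ((hg.continuous.mul hψ2).integrable_of_hasCompactSupport hc2.mul_left)
    ((hg.continuous.mul hψ1.continuous).integrable_of_hasCompactSupport hc1.mul_left)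
    (fun y _ => hg.differentiable two_ne_zero y)
    (fun y _ => hψ1.differentiable one_ne_zero y)
  have h2 := integral_mul_fderiv_eq_neg_fderiv_mul_of_integrable (μ := (volume : Measure Space))
    (f := fun z => fderiv ℝ g z e) (g := ψ) (v := e)
    ((hg2.mul hψ.continuous).integrable_of_hasCompactSupport hc.mul_left)
    ((hg1.continuous.mul hψ1.continuous).integrable_of_hasCompactSupport hc1.mul_left)
    ((hg1.continuous.mul hψ.continuous).integrable_of_hasCompactSupport hc.mul_left)
    (fun y _ => hg1.differentiable one_ne_zero y)
    (fun y _ => hψ.differentiable two_ne_zero y)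
  exact h1.trans (neg_eq_iff_eq_neg.2 h2)

lemma continuous_laplacian {ψ : Space → ℝ} (hψ : ContDiff ℝ 2 ψ) : Continuous (Δ ψ) := by
  rw [funext (laplacian_eq_sum_secondDeriv hψ)]
  exact continuous_finsetSum _ fun i _ => continuous_secondDeriv hψ i

lemma hasCompactSupport_secondDeriv {ψ : Space → ℝ} (hc : HasCompactSupport ψ) (i : Fin 3) :
    HasCompactSupport (secondDeriv i ψ) :=
  (hc.fderiv_apply ℝ (EuclideanSpace.single i 1)).fderiv_apply ℝ _

lemma hasCompactSupport_laplacian {ψ : Space → ℝ} (hψ : ContDiff ℝ 2 ψ)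
    (hc : HasCompactSupport ψ) : HasCompactSupport (Δ ψ) := by
  refine HasCompactSupport.intro hc fun y hy => ?_
  rw [laplacian_eq_sum_secondDeriv hψ]
  refine Finset.sum_eq_zero fun i _ => ?_
  by_contra h
  have h1 := subset_tsupport (secondDeriv i ψ) h
  have h2 := (tsupport_fderiv_apply_subset ℝ (f := fun z => fderiv ℝ ψ z (EuclideanSpace.single i 1))
    (EuclideanSpace.single i 1)) h1
  exact hy ((tsupport_fderiv_apply_subset ℝ (EuclideanSpace.single i 1)) h2)

lemma integral_mul_laplacian {g ψ : Space → ℝ} (hg : ContDiff ℝ 2 g) (hψ : ContDiff ℝ 2 ψ)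
    (hc : HasCompactSupport ψ) : ∫ y, g y * Δ ψ y = ∫ y, Δ g y * ψ y := by
  simp only [laplacian_eq_sum_secondDeriv hψ, laplacian_eq_sum_secondDeriv hg, Finset.mul_sum,
    Finset.sum_mul]
  rw [integral_finsetSum, integral_finsetSum]
  · exact Finset.sum_congr rfl fun i _ => integral_mul_secondDeriv hg hψ hc i
  · exact fun i _ => ((continuous_secondDeriv hg i).mul
      hψ.continuous).integrable_of_hasCompactSupport hc.mul_left
  · exact fun i _ => (hg.continuous.mul
      (continuous_secondDeriv hψ i)).integrable_of_hasCompactSupport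
        (hasCompactSupport_secondDeriv hc i).mul_left

lemma contDiff_gaussKernel_sub (t : ℝ) (a : Space) :
    ContDiff ℝ 2 fun y => gaussKernel t (y - a) :=
  ((contDiff_const.mul ((contDiff_id.sub contDiff_const).norm_sq ℝ)).neg).exp

lemma laplacian_gaussKernel (t : ℝ) (a y : Space) :
    Δ (fun y => gaussKernel t (y - a)) y
      = (4 * t ^ 4 * ‖y - a‖ ^ 2 - 6 * t ^ 2) * gaussKernel t (y - a) := by
  have hd : ∀ z : Space, HasFDerivAt (fun y => gaussKernel t (y - a))
      (gaussKernel t (z - a) • (-((2 * t ^ 2) • (innerSL ℝ (z - a) : Space →L[ℝ] ℝ)))) z := by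
    intro z
    have h := (((hasFDerivAt_id (𝕜 := ℝ) z).sub_const a).norm_sq.const_mul (t ^ 2)).neg.exp
    refine h.congr_fderiv ?_
    ext w
    simp [gaussKernel]
    ring
  have h1 : ∀ (i : Fin 3) (z : Space), fderiv ℝ (fun y => gaussKernel t (y - a)) z
      (EuclideanSpace.single i 1) = gaussKernel t (z - a) * (-(2 * t ^ 2 * (z i - a i))) := by
    intro i z
    rw [(hd z).fderiv]
    simp [EuclideanSpace.inner_single_right]
  have h2 : ∀ i : Fin 3, secondDeriv i (fun y => gaussKernel t (y - a)) y
      = (4 * t ^ 4 * (y i - a i) ^ 2 - 2 * t ^ 2) * gaussKernel t (y - a) := by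
    intro i
    rw [secondDeriv]
    simp only [h1]
    have hc : HasFDerivAt (fun z : Space => -(2 * t ^ 2 * (z i - a i)))
        (-((2 * t ^ 2) • (EuclideanSpace.proj i : Space →L[ℝ] ℝ))) y :=
      ((((EuclideanSpace.proj i : Space →L[ℝ] ℝ).hasFDerivAt).sub_const
        (a i)).const_mul (2 * t ^ 2)).neg
    have hm : HasFDerivAt (fun z => gaussKernel t (z - a) * (-(2 * t ^ 2 * (z i - a i)))) _ y :=
      (hd y).mul hc
    rw [hm.fderiv]
    simp [EuclideanSpace.inner_single_right]
    ring
  rw [laplacian_eq_sum_secondDeriv (contDiff_gaussKernel_sub t a), EuclideanSpace.norm_sq_eq]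
  simp only [h2, Fin.sum_univ_three, PiLp.sub_apply, Real.norm_eq_abs, sq_abs]
  ring

/-- The integrability needed for interchanging the integrals over space and over the width. -/
lemma integrable_prod_of_continuous {F : Space × ℝ → ℝ} (hF : Continuous F) {K : Set Space}
    (hK : IsCompact K) (h0 : ∀ y ∉ K, ∀ t, F (y, t) = 0) (T : ℝ) :
    Integrable F ((volume : Measure Space).prod (volume.restrict (Set.Ioc 0 T))) := by
  have h1 : IntegrableOn F (K ×ˢ Set.Ioc 0 T) ((volume : Measure Space).prod volume) :=
    (hF.continuousOn.integrableOn_compact (hK.prod isCompact_Icc)).mono_set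
      (Set.prod_mono_right Set.Ioc_subset_Icc_self)
  have h2 : IntegrableOn F (Set.univ ×ˢ Set.Ioc 0 T) ((volume : Measure Space).prod volume) := by
    refine h1.of_forall_sdiff_eq_zero (MeasurableSet.univ.prod measurableSet_Ioc) ?_
    rintro ⟨y, t⟩ ⟨h, h'⟩
    exact h0 y (fun hy => h' ⟨hy, h.2⟩) t
  rwa [IntegrableOn, ← Measure.prod_restrict, Measure.restrict_univ] at h2

lemma integral_width_laplacian_gaussKernel (T : ℝ) (hT : 0 ≤ T) (v : Space) :
    ∫ t in Set.Ioc 0 T, (6 * t ^ 2 - 4 * t ^ 4 * ‖v‖ ^ 2) * gaussKernel t v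
      = 2 * T ^ 3 * gaussKernel T v := by
  have hd : ∀ t ∈ Set.uIcc 0 T, HasDerivAt (fun t => 2 * t ^ 3 * gaussKernel t v)
      ((6 * t ^ 2 - 4 * t ^ 4 * ‖v‖ ^ 2) * gaussKernel t v) t := by
    intro t _
    have h := ((hasDerivAt_pow 3 t).const_mul 2).mul
      ((((hasDerivAt_pow 2 t).mul_const (‖v‖ ^ 2)).neg).exp)
    refine h.congr_deriv ?_
    simp only [gaussKernel]
    norm_num
    ring
  have hc : Continuous fun t : ℝ => (6 * t ^ 2 - 4 * t ^ 4 * ‖v‖ ^ 2) * gaussKernel t v := by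
    unfold gaussKernel; fun_prop
  rw [← intervalIntegral.integral_of_le hT,
    intervalIntegral.integral_eq_sub_of_hasDerivAt hd (hc.intervalIntegrable _ _)]
  simp

/-- The Laplacian of the long-range part of the Coulomb kernel is a Gaussian, in weak form: the
Laplacian of a Gaussian of width `1 / t` is a derivative with respect to `t`. -/
lemma integral_width_mul_neg_laplacian {ψ : Space → ℝ} (hψ : ContDiff ℝ 2 ψ)
    (hc : HasCompactSupport ψ) (a : Space) {T : ℝ} (hT : 0 ≤ T) :
    ∫ y, (2 / √Real.pi * ∫ t in (0 : ℝ)..T, gaussKernel t (y - a)) * (-(Δ ψ y))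
      = 4 / √Real.pi * ∫ y, T ^ 3 * gaussKernel T (y - a) * ψ y := by
  have hG : Continuous fun p : Space × ℝ => gaussKernel p.2 (p.1 - a) := by
    unfold gaussKernel; fun_prop
  have hΔ := continuous_laplacian hψ
  have e1 : ∀ y, (2 / √Real.pi * ∫ t in (0 : ℝ)..T, gaussKernel t (y - a)) * (-(Δ ψ y))
      = ∫ t in Set.Ioc 0 T, 2 / √Real.pi * (gaussKernel t (y - a) * (-(Δ ψ y))) := by
    intro y
    rw [intervalIntegral.integral_of_le hT, integral_const_mul, integral_mul_const]; ring
  simp_rw [e1]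
  rw [integral_integral_swap]
  swap
  · refine integrable_prod_of_continuous (K := tsupport (Δ ψ))
      (continuous_const.mul (hG.mul (hΔ.comp continuous_fst).neg))
      (hasCompactSupport_laplacian hψ hc) (fun y hy t => ?_) T
    simp [image_eq_zero_of_notMem_tsupport hy]
  have e2 : ∀ t, ∫ y, 2 / √Real.pi * (gaussKernel t (y - a) * (-(Δ ψ y)))
      = ∫ y, 2 / √Real.pi * ((6 * t ^ 2 - 4 * t ^ 4 * ‖y - a‖ ^ 2) * gaussKernel t (y - a)) * ψ y := by
    intro t
    have h := integral_mul_laplacian (contDiff_gaussKernel_sub t a) hψ hc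
    simp only [laplacian_gaussKernel] at h
    simp only [mul_neg, integral_neg, mul_assoc, integral_const_mul, h]
    rw [← mul_neg, ← integral_neg]
    congr 2; ext y; ring
  simp_rw [e2]
  rw [integral_integral_swap]
  swap
  · refine (integrable_prod_of_continuous (K := tsupport ψ)
      (F := fun p => 2 / √Real.pi * ((6 * p.2 ^ 2 - 4 * p.2 ^ 4 * ‖p.1 - a‖ ^ 2)
        * gaussKernel p.2 (p.1 - a)) * ψ p.1)
      ((continuous_const.mul (Continuous.mul (by fun_prop) hG)).mul
        (hψ.continuous.comp continuous_fst)) hc (fun y hy t => ?_) T).swap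
    simp [image_eq_zero_of_notMem_tsupport hy]
  rw [← integral_const_mul]
  congr 1; ext y
  rw [integral_mul_const, integral_const_mul, integral_width_laplacian_gaussKernel T hT]
  ring

/-- Gaussians of width `1 / T` are an approximate identity up to normalisation. -/
lemma tendsto_integral_gaussKernel {ψ : Space → ℝ} (hψ : Continuous ψ) (hc : HasCompactSupport ψ)
    (a : Space) : Tendsto (fun T : ℝ => ∫ y, T ^ 3 * gaussKernel T (y - a) * ψ y) atTop
      (𝓝 (Real.pi ^ (3 / 2 : ℝ) * ψ a)) := by
  have hπ := Real.pi_pos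
  have hp : (0 : ℝ) < Real.pi ^ (3 / 2 : ℝ) := by positivity
  have hi : Integrable fun x => ψ (x + a) :=
    (hψ.integrable_of_hasCompactSupport hc).comp_add_right a
  have hdim : Module.finrank ℝ Space = 3 := by simp
  have h := tendsto_integral_comp_smul_smul_of_integrable (μ := (volume : Measure Space))
    (φ := fun x => (Real.pi ^ (3 / 2 : ℝ))⁻¹ * Real.exp (-1 * ‖x‖ ^ 2))
    (fun x => by positivity) ?_ ?_ hi (by fun_prop)
  · have h2 := h.const_mul (Real.pi ^ (3 / 2 : ℝ))
    simp only [zero_add] at h2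
    refine h2.congr fun T => ?_
    rw [← integral_sub_right_eq_self _ a, ← integral_const_mul]
    congr 1; ext y
    simp only [hdim, sub_add_cancel, smul_eq_mul, gaussKernel, norm_smul, mul_pow, Real.norm_eq_abs,
      sq_abs, neg_one_mul]
    field_simp
  · rw [integral_const_mul, GaussianFourier.integral_rexp_neg_mul_sq_norm one_pos, hdim, div_one]
    norm_num
    exact inv_mul_cancel₀ hp.ne'
  · have h1 : Tendsto (fun s : ℝ => s ^ 3 * Real.exp (-s)) atTop (𝓝 0) :=
      Real.tendsto_pow_mul_exp_neg_atTop_nhds_zero 3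
    have h2 : Tendsto (fun s : ℝ => s ^ 3 * ((Real.pi ^ (3 / 2 : ℝ))⁻¹ * Real.exp (-1 * s ^ 2)))
        atTop (𝓝 0) := by
      have h3 := h1.const_mul (Real.pi ^ (3 / 2 : ℝ))⁻¹
      rw [mul_zero] at h3
      refine tendsto_of_tendsto_of_tendsto_of_le_of_le' tendsto_const_nhds h3 ?_ ?_
      · filter_upwards [eventually_ge_atTop 1] with s hs
        positivity
      · filter_upwards [eventually_ge_atTop 1] with s hs
        have : Real.exp (-1 * s ^ 2) ≤ Real.exp (-s) := Real.exp_le_exp.2 (by nlinarith)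
        calc _ = (Real.pi ^ (3 / 2 : ℝ))⁻¹ * (s ^ 3 * Real.exp (-1 * s ^ 2)) := by ring
          _ ≤ _ := by gcongr
    rw [hdim]
    exact h2.comp tendsto_norm_cobounded_atTop

lemma integrableOn_inv_norm_sub_ball (a : Space) (r : ℝ) :
    IntegrableOn (fun y : Space => 1 / ‖y - a‖) (Metric.ball a r) := by
  have h0 : IntegrableOn (fun y : Space => 1 / ‖y‖) (Metric.ball 0 r) := by
    refine (integrableOn_fun_norm_addHaar (f := fun s : ℝ => 1 / s) volume).2 ?_
    have h : IntegrableOn (fun y : ℝ => y) (Set.Ioo 0 r) :=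
      (continuous_id.integrableOn_Icc (a := 0) (b := r)).mono_set Set.Ioo_subset_Icc_self
    refine h.congr_fun (fun y hy => ?_) measurableSet_Ioo
    have : y ≠ 0 := hy.1.ne'
    simp
    field_simp
  have h1 := (measurePreserving_sub_right volume a).integrableOn_comp_preimage
    (measurableEmbedding_subRight a) (f := fun y : Space => 1 / ‖y‖) (s := Metric.ball 0 r)
  rw [← h1] at h0
  convert! h0 using 1
  ext y
  simp [dist_eq_norm]

lemma locallyIntegrable_inv_norm_sub (a : Space) :
    LocallyIntegrable (fun y : Space => 1 / ‖y - a‖) volume := by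
  intro y
  refine ⟨Metric.ball a (dist y a + 1), Metric.isOpen_ball.mem_nhds (by simp),
    integrableOn_inv_norm_sub_ball a _⟩

lemma integrable_mul_of_hasCompactSupport {f g : Space → ℝ}
    (hf : LocallyIntegrable f volume) (hg : Continuous g) (hc : HasCompactSupport g) :
    Integrable fun y => f y * g y := by
  have := hf.integrable_smul_right_of_hasCompactSupport hg hc
  simpa using this

/-- The Coulomb kernel is a fundamental solution of `-Δ u = 4π δ` in three dimensions. -/
theorem integral_inv_norm_mul_neg_laplacian {ψ : Space → ℝ} (hψ : ContDiff ℝ 2 ψ)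
    (hc : HasCompactSupport ψ) (a : Space) :
    ∫ y, 1 / ‖y - a‖ * (-(Δ ψ y)) = 4 * Real.pi * ψ a := by
  have hπ := Real.pi_pos
  have hsπ := Real.sqrt_pos.2 hπ
  have hΔ : Continuous fun y => -(Δ ψ y) := (continuous_laplacian hψ).neg
  have hΔc : HasCompactSupport fun y => -(Δ ψ y) := (hasCompactSupport_laplacian hψ hc).neg
  have hbd := integrable_mul_of_hasCompactSupport
    (locallyIntegrable_inv_norm_sub a) hΔ hΔc
  have hE : ∀ y, y ≠ a → ∀ T : ℝ, 2 / √Real.pi * (∫ t in (0 : ℝ)..T, gaussKernel t (y - a))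
      = erf (T * ‖y - a‖) / ‖y - a‖ := fun y hy T =>
    integral_exp_neg_sq_mul_sq T (norm_ne_zero_iff.2 (sub_ne_zero.2 hy))
  have hae : ∀ᵐ y ∂(volume : Measure Space), y ≠ a := by
    simp [ae_iff, measure_singleton]
  -- the truncated width integral increases to the Coulomb kernel, which dominates it
  have h1 : Tendsto (fun T : ℝ => ∫ y, (2 / √Real.pi * ∫ t in (0 : ℝ)..T, gaussKernel t (y - a))
      * (-(Δ ψ y))) atTop (𝓝 (∫ y, 1 / ‖y - a‖ * (-(Δ ψ y)))) := by
    refine tendsto_integral_filter_of_dominated_convergence _ ?_ ?_ hbd.norm ?_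
    · refine Eventually.of_forall fun T => Continuous.aestronglyMeasurable ?_
      refine (continuous_const.mul ?_).mul hΔ
      refine intervalIntegral.continuous_parametric_intervalIntegral_of_continuous' ?_ 0 T
      unfold Function.uncurry gaussKernel; fun_prop
    · filter_upwards [eventually_ge_atTop 0] with T hT
      filter_upwards [hae] with y hy
      rw [hE y hy, norm_mul, norm_mul]
      gcongr
      rw [Real.norm_eq_abs, Real.norm_eq_abs, abs_of_nonneg (by positivity : 0 ≤ 1 / ‖y - a‖),
        abs_of_nonneg (div_nonneg (erf_nonneg (by positivity)) (norm_nonneg _))]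
      gcongr
      exact erf_le_one _
    · filter_upwards [hae] with y hy
      simp only [hE y hy]
      have : Tendsto (fun T : ℝ => T * ‖y - a‖) atTop atTop :=
        tendsto_id.atTop_mul_const (norm_pos_iff.2 (sub_ne_zero.2 hy))
      exact ((tendsto_erf_atTop.comp this).div_const _).mul_const _
  have h2 := (tendsto_integral_gaussKernel hψ.continuous hc a).const_mul (4 / √Real.pi)
  have h3 := tendsto_nhds_unique (h1.congr' ((eventually_ge_atTop 0).mono fun T hT =>
    integral_width_mul_neg_laplacian hψ hc a hT)) h2
  rw [h3, ← mul_assoc]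
  congr 1
  have : Real.pi ^ (3 / 2 : ℝ) = Real.pi * √Real.pi := by
    rw [Real.sqrt_eq_rpow, ← Real.rpow_one_add' hπ.le (by norm_num)]; norm_num
  rw [this]; field_simp

/-! ### The symmetric Coulomb sum as a solution of the Poisson problem -/

/-- The Coulomb potential of all periodic images, summed in symmetric order. -/
noncomputable def pot {N : ℕ} (L : ℝ) (q : Fin N → ℝ) (x : Fin N → Space) (y : Space) : ℝ :=
  ∑' p, symCell L q (fun n => y - x n) p

section pot

variable {N : ℕ} {L ξ : ℝ} {q : Fin N → ℝ} (x : Fin N → Space)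

lemma exists_norm_sub_le (R : ℝ) : ∃ R', ∀ y : Space, ‖y‖ ≤ R → ∀ n, ‖y - x n‖ ≤ R' := by
  refine ⟨R + ∑ n, ‖x n‖, fun y hy n => (norm_sub_le _ _).trans (add_le_add hy ?_)⟩
  exact Finset.single_le_sum (f := fun n => ‖x n‖) (fun _ _ => norm_nonneg _) (Finset.mem_univ n)

lemma continuousAt_symCell {y₀ : Space} {p : ℤ × ℤ}
    (h : ∀ n, y₀ - x n + shift L p ≠ 0 ∧ y₀ - x n - shift L p ≠ 0) :
    ContinuousAt (fun y => symCell L q (fun n => y - x n) p) y₀ := by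
  unfold symCell symAvg
  refine tendsto_finsetSum _ fun n _ => ?_
  have h1 : ContinuousAt (fun y => 1 / ‖y - x n + shift L p‖) y₀ :=
    continuousAt_const.div (by fun_prop) (norm_ne_zero_iff.2 (h n).1)
  have h2 : ContinuousAt (fun y => 1 / ‖y - x n - shift L p‖) y₀ :=
    continuousAt_const.div (by fun_prop) (norm_ne_zero_iff.2 (h n).2)
  exact ((h1.add h2).div_const 2).const_mul _

/-- On a ball the potential is a finite sum of Coulomb kernels plus a continuous function. -/
lemma exists_pot_eq_sum_add (hL : 0 < L) (hq : ∑ n, q n = 0) (R : ℝ) :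
    ∃ (S : Finset (ℤ × ℤ)) (tail : Space → ℝ), ContinuousOn tail (Metric.ball 0 R) ∧
      (∀ p ∉ S, ∀ y ∈ Metric.ball (0 : Space) R, ∀ n,
        y - x n + shift L p ≠ 0 ∧ y - x n - shift L p ≠ 0) ∧
      ∀ y, pot L q x y = ∑ p ∈ S, symCell L q (fun n => y - x n) p + tail y := by
  obtain ⟨R', hR'⟩ := exists_norm_sub_le x R
  obtain ⟨S, B, hB, hS⟩ := exists_symCell_bound hL hq R'
  have hS' : ∀ p ∉ S, ∀ y ∈ Metric.ball (0 : Space) R, _ := fun p hp y hy =>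
    hS p hp (fun n => y - x n) (hR' y (by simpa using (Metric.mem_ball.1 hy).le))
  refine ⟨S, fun y => ∑' p : {p // p ∉ S}, symCell L q (fun n => y - x n) p, ?_,
    fun p hp y hy => (hS' p hp y hy).1, fun y => ?_⟩
  · refine continuousOn_tsum (fun p y hy => ?_) (hB.subtype _) fun p y hy => ?_
    · exact (continuousAt_symCell x (hS' p p.2 y hy).1).continuousWithinAt
    · exact (hS' p p.2 y hy).2
  · exact ((hasSum_symCell hL one_pos hq _).summable.sum_add_tsum_subtype_compl S).symm

lemma sub_add_shift_ne_zero {y : Space} (hy : y ∉ sites L x) (n : Fin N) (p : ℤ × ℤ) :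
    y - x n + shift L p ≠ 0 ∧ y - x n - shift L p ≠ 0 := by
  constructor <;> intro h
  · exact hy ⟨n, p, by rw [← sub_eq_zero, ← h]; abel⟩
  · exact hy ⟨n, -p, by rw [← sub_eq_zero, ← h, shift_neg]; abel⟩

lemma continuousOn_pot (hL : 0 < L) (hq : ∑ n, q n = 0) :
    ContinuousOn (pot L q x) (sites L x)ᶜ := by
  intro y₀ hy₀
  obtain ⟨S, tail, htail, -, hpot⟩ := exists_pot_eq_sum_add x hL hq (‖y₀‖ + 1)
  have h1 : ContinuousAt tail y₀ :=
    htail.continuousAt (Metric.isOpen_ball.mem_nhds (by simp))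
  rw [funext hpot]
  refine (ContinuousAt.add (tendsto_finsetSum _ fun p _ => ?_) h1).continuousWithinAt
  exact continuousAt_symCell x fun n => sub_add_shift_ne_zero x hy₀ n p

lemma shift_ne_zero (hL : 0 < L) {p : ℤ × ℤ} (hp : p ≠ 0) : shift L p ≠ 0 := by
  intro h
  apply hp
  have h0 := congrArg (fun v : Space => v 0) h
  have h1 := congrArg (fun v : Space => v 1) h
  simp [shift, hL.ne'] at h0 h1
  exact Prod.ext h0 h1

/-- Without the kernel of the `m`-th particle, the potential is continuous at this particle. Its
value there is `pot L q x (x m)` because `1 / ‖0‖ = 0`. -/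
lemma continuousAt_pot_sub (hL : 0 < L) (hq : ∑ n, q n = 0)
    (hdistinct : ∀ m n : Fin N, m ≠ n → ∀ p : ℤ × ℤ, x m - x n + shift L p ≠ 0) (m : Fin N) :
    ContinuousAt (fun y => pot L q x y - q m / ‖y - x m‖) (x m) := by
  obtain ⟨S, tail, htail, hS, hpot⟩ := exists_pot_eq_sum_add x hL hq (‖x m‖ + 1)
  have hmem : x m ∈ Metric.ball (0 : Space) (‖x m‖ + 1) := by simp
  have h1 : ContinuousAt tail (x m) := htail.continuousAt (Metric.isOpen_ball.mem_nhds hmem)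
  have h0 : (0 : ℤ × ℤ) ∈ S := by
    by_contra h
    exact (hS 0 h (x m) hmem m).1 (by simp [shift_zero])
  have heq : (fun y => pot L q x y - q m / ‖y - x m‖) = fun y =>
      ∑ p ∈ S, ∑ n, (q n * ((1 / ‖y - x n + shift L p‖ + 1 / ‖y - x n - shift L p‖) / 2)
        - if p = 0 then if n = m then q m / ‖y - x m‖ else 0 else 0) + tail y := by
    ext y
    have : ∑ p ∈ S, ∑ n, (if p = 0 then if n = m then q m / ‖y - x m‖ else 0 else 0)
        = q m / ‖y - x m‖ := by
      rw [Finset.sum_comm]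
      simp [h0]
    simp only [Finset.sum_sub_distrib, this, hpot]
    simp only [symCell, symAvg]
    ring
  rw [heq]
  refine ContinuousAt.add (tendsto_finsetSum _ fun p _ => tendsto_finsetSum _ fun n _ => ?_) h1
  change ContinuousAt (fun y => q n * ((1 / ‖y - x n + shift L p‖ + 1 / ‖y - x n - shift L p‖) / 2)
    - if p = 0 then if n = m then q m / ‖y - x m‖ else 0 else 0) (x m)
  by_cases hpn : p = 0 ∧ n = m
  · obtain ⟨rfl, rfl⟩ := hpn
    have : ∀ y, q n * ((1 / ‖y - x n + shift L 0‖ + 1 / ‖y - x n - shift L 0‖) / 2)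
        - (if (0 : ℤ × ℤ) = 0 then if n = n then q n / ‖y - x n‖ else 0 else 0) = 0 := by
      intro y
      simp only [shift_zero, add_zero, sub_zero, if_true]
      ring
    exact (continuousAt_const (y := (0 : ℝ))).congr (Eventually.of_forall fun y => (this y).symm)
  · have hne : ∀ p' : ℤ × ℤ, ¬ (p' = 0 ∧ n = m) → x m - x n + shift L p' ≠ 0 := by
      intro p' h
      by_cases hn : n = m
      · subst hn
        simpa using shift_ne_zero hL (fun h' => h ⟨h', rfl⟩)
      · exact hdistinct m n (Ne.symm hn) p'
    have hne1 := hne p hpn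
    have hne2 : x m - x n - shift L p ≠ 0 := by
      rw [sub_eq_add_neg, ← shift_neg]
      exact hne (-p) (by simpa using hpn)
    have hz : ∀ y, (if p = 0 then if n = m then q m / ‖y - x m‖ else 0 else 0) = 0 := by
      intro y
      rcases not_and_or.1 hpn with h | h <;> simp [h]
    simp only [hz, sub_zero]
    have c1 : ContinuousAt (fun y => 1 / ‖y - x n + shift L p‖) (x m) :=
      continuousAt_const.div (by fun_prop) (norm_ne_zero_iff.2 hne1)
    have c2 : ContinuousAt (fun y => 1 / ‖y - x n - shift L p‖) (x m) :=
      continuousAt_const.div (by fun_prop) (norm_ne_zero_iff.2 hne2)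
    exact ((c1.add c2).div_const 2).const_mul _

lemma symCell_sub_eq (L : ℝ) (q : Fin N → ℝ) (y : Space) (p : ℤ × ℤ) :
    symCell L q (fun n => y - x n) p = ∑ n, (q n / 2 * (1 / ‖y - (x n - shift L p)‖)
      + q n / 2 * (1 / ‖y - (x n + shift L p)‖)) := by
  refine Finset.sum_congr rfl fun n _ => ?_
  rw [← sub_add, ← sub_sub]
  ring

lemma locallyIntegrable_symCell (L : ℝ) (q : Fin N → ℝ) (p : ℤ × ℤ) :
    LocallyIntegrable (fun y => symCell L q (fun n => y - x n) p) volume := by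
  simp only [symCell_sub_eq]
  refine locallyIntegrable_finsetSum _ fun n _ => ?_
  exact ((locallyIntegrable_inv_norm_sub _).smul (q n / 2)).add
    ((locallyIntegrable_inv_norm_sub _).smul (q n / 2))

lemma locallyIntegrable_pot (hL : 0 < L) (hq : ∑ n, q n = 0) :
    LocallyIntegrable (pot L q x) volume := by
  intro y₀
  obtain ⟨S, tail, htail, -, hpot⟩ := exists_pot_eq_sum_add x hL hq (‖y₀‖ + 2)
  refine ⟨Metric.closedBall 0 (‖y₀‖ + 1), mem_of_superset (Metric.isOpen_ball.mem_nhds (by simp))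
    Metric.ball_subset_closedBall, ?_⟩
  have hK : IsCompact (Metric.closedBall (0 : Space) (‖y₀‖ + 1)) := isCompact_closedBall _ _
  rw [funext hpot]
  refine IntegrableOn.add ?_ ?_
  · exact (locallyIntegrable_finsetSum S fun p _ =>
      locallyIntegrable_symCell x L q p).integrableOn_isCompact hK
  · exact (htail.mono (Metric.closedBall_subset_ball (by linarith))).integrableOn_compact hK

lemma integral_symCell_mul_neg_laplacian {ψ : Space → ℝ} (hψ : ContDiff ℝ 2 ψ)
    (hc : HasCompactSupport ψ) (p : ℤ × ℤ) :
    ∫ y, symCell L q (fun n => y - x n) p * (-(Δ ψ y))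
      = symAvg (fun v => 4 * Real.pi * ψ (-v)) L q (fun n => -x n) p := by
  have hΔ : Continuous fun y => -(Δ ψ y) := (continuous_laplacian hψ).neg
  have hΔc : HasCompactSupport fun y => -(Δ ψ y) := (hasCompactSupport_laplacian hψ hc).neg
  have hi : ∀ (c : ℝ) (a : Space), Integrable fun y => c * (1 / ‖y - a‖) * (-(Δ ψ y)) :=
    fun c a => integrable_mul_of_hasCompactSupport
      ((locallyIntegrable_inv_norm_sub a).smul c) hΔ hΔc
  simp only [symCell_sub_eq, Finset.sum_mul, add_mul]
  rw [integral_finsetSum]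
  swap
  · exact fun n _ => (hi _ _).add (hi _ _)
  refine Finset.sum_congr rfl fun n _ => ?_
  rw [integral_add (hi _ _) (hi _ _)]
  simp only [mul_assoc, integral_const_mul, integral_inv_norm_mul_neg_laplacian hψ hc]
  have h1 : -(-x n + shift L p) = x n - shift L p := by abel
  have h2 : -(-x n - shift L p) = x n + shift L p := by abel
  rw [h1, h2]
  ring

lemma summable_comp_sub_shift (hL : 0 < L) {ψ : Space → ℝ} (hc : HasCompactSupport ψ) (a : Space) :
    Summable fun p : ℤ × ℤ => ψ (a - shift L p) := by
  obtain ⟨R, hR⟩ := hc.isCompact.isBounded.exists_norm_le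
  refine summable_of_hasFiniteSupport ((eventually_cofinite.1
    (eventually_le_norm_shift hL (‖a‖ + R + 1))).subset fun p hp h => ?_)
  have h1 := hR _ (subset_tsupport _ hp)
  have h2 : ‖shift L p‖ ≤ ‖a - shift L p‖ + ‖a‖ := by
    have := norm_sub_le a (a - shift L p)
    rw [sub_sub_cancel] at this
    linarith
  linarith

lemma pot_poisson (hL : 0 < L) (hq : ∑ n, q n = 0) {ψ : Space → ℝ} (hψ : ContDiff ℝ 2 ψ)
    (hc : HasCompactSupport ψ) : ∫ y, pot L q x y * (-(Δ ψ y))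
      = 4 * Real.pi * ∑ n, ∑' p : ℤ × ℤ, q n * ψ (x n - shift L p) := by
  have hΔ : Continuous fun y => -(Δ ψ y) := (continuous_laplacian hψ).neg
  have hΔc : HasCompactSupport fun y => -(Δ ψ y) := (hasCompactSupport_laplacian hψ hc).neg
  have hi : ∀ p, Integrable fun y => symCell L q (fun n => y - x n) p * (-(Δ ψ y)) := fun p =>
    integrable_mul_of_hasCompactSupport (locallyIntegrable_symCell x L q p) hΔ hΔc
  have hΔi : Integrable fun y => ‖-(Δ ψ y)‖ := (hΔ.integrable_of_hasCompactSupport hΔc).norm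
  obtain ⟨R, hR⟩ := hΔc.isCompact.isBounded.exists_norm_le
  obtain ⟨R', hR'⟩ := exists_norm_sub_le x R
  obtain ⟨S, B, hB, hS⟩ := exists_symCell_bound hL hq R'
  have hsum : Summable fun p => ∫ y, ‖symCell L q (fun n => y - x n) p * (-(Δ ψ y))‖ := by
    refine Summable.of_norm_bounded_eventually (hB.mul_right (∫ y, ‖-(Δ ψ y)‖)) ?_
    filter_upwards [S.finite_toSet.compl_mem_cofinite] with p hp
    rw [Real.norm_eq_abs, abs_of_nonneg (integral_nonneg fun _ => norm_nonneg _),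
      ← integral_const_mul]
    refine integral_mono (hi p).norm (hΔi.const_mul _) fun y => ?_
    by_cases hy : y ∈ tsupport fun y => -(Δ ψ y)
    · simp only [norm_mul]
      gcongr
      exact (hS p hp _ (hR' y (hR y hy))).2
    · have : -(Δ ψ y) = 0 := image_eq_zero_of_notMem_tsupport (f := fun y => -(Δ ψ y)) hy
      simp only [this, mul_zero, norm_zero, le_refl]
  have h1 := hasSum_integral_of_summable_integral_norm hi hsum
  simp only [integral_symCell_mul_neg_laplacian x hψ hc, tsum_mul_right] at h1
  have hs : ∀ n, Summable fun p => 4 * Real.pi * ψ (-(-x n + shift L p)) := fun n => by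
    simp only [neg_add_eq_sub, neg_sub]
    exact (summable_comp_sub_shift hL hc (x n)).mul_left _
  have h2 := hasSum_symAvg (f := fun v => 4 * Real.pi * ψ (-v)) (L := L) q
    (v := fun n => -x n) hs
  have h3 := h1.unique h2
  simp only [pot]
  rw [h3, Finset.mul_sum]
  refine Finset.sum_congr rfl fun n _ => ?_
  simp only [neg_add_eq_sub, neg_sub, tsum_mul_left]
  ring

lemma tsum_add_shift (f : Space → ℝ) (v : Space) (e : ℤ × ℤ) :
    ∑' p : ℤ × ℤ, f (v + shift L e + shift L p) = ∑' p : ℤ × ℤ, f (v + shift L p) := by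
  rw [← (Equiv.addRight e).tsum_eq fun p => f (v + shift L p)]
  congr 1; ext p
  rw [Equiv.coe_addRight, shift_add, add_assoc, add_comm (shift L e)]

lemma pot_eq (hL : 0 < L) (hξ : 0 < ξ) (hq : ∑ n, q n = 0) (y : Space) : pot L q x y
    = ∑ n, q n * ∑' p, erfc (ξ * ‖y - x n + shift L p‖) / ‖y - x n + shift L p‖
      + 2 / √Real.pi * (∫ t in (0 : ℝ)..ξ, ∑ n, q n * gaussSum L t (y - x n))
      - ∑ n, q n * ∑' p : ℤ × ℤ, if y - x n + shift L p = 0 then 2 * ξ / √Real.pi else 0 :=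
  (hasSum_symCell hL hξ hq _).tsum_eq

/-- Symmetric summation is not visibly invariant under translations, but the two parts of the Ewald
splitting are. -/
lemma pot_periodic (hL : 0 < L) (hq : ∑ n, q n = 0) (p : ℤ × ℤ) (y : Space) :
    pot L q x (y + shift L p) = pot L q x y := by
  rw [pot_eq x hL one_pos hq, pot_eq x hL one_pos hq]
  simp only [add_sub_right_comm, gaussSum]
  simp only [tsum_add_shift (fun w => erfc (1 * ‖w‖) / ‖w‖),
    tsum_add_shift (fun w => if w = 0 then 2 * 1 / √Real.pi else 0),
    fun t : ℝ => tsum_add_shift (L := L) (fun w => Real.exp (-(t ^ 2 * ‖w‖ ^ 2)))]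

/-! ### The limits in the free direction -/

lemma norm_waveSum_le (hL : 0 < L) (hξ : 0 < ξ) (v : Space) : ‖waveSum L ξ v‖
    ≤ (∑' j : {j : ℤ × ℤ // j ≠ 0}, 8 / (2 * Real.pi / L) ^ 2
      * Real.exp (-(1 / (8 * ξ ^ 2) * ‖waveVec L j‖ ^ 2)))
      * ∫ t in (0 : ℝ)..ξ, Real.exp (-(t ^ 2 * v 2 ^ 2)) := by
  have hπ := Real.pi_pos
  rw [← tsum_mul_right]
  refine tsum_of_norm_bounded (Summable.hasSum (((summable_exp_neg_norm_waveVec_ne hL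
    (by positivity)).mul_left _).mul_right _)) fun j => ?_
  rw [norm_mul, norm_planeWave, one_mul, Complex.norm_real, Real.norm_eq_abs,
    abs_of_nonneg (widthIntegral_nonneg hξ.le _ _), ← intervalIntegral.integral_const_mul]
  exact intervalIntegral.integral_mono_on_of_le_Ioo hξ.le
    (intervalIntegrable_widthIntegrand hξ.le (norm_waveVec_pos hL j.2).ne' _)
    (Continuous.intervalIntegrable (by fun_prop) _ _)
    fun t ht => widthIntegrand_le (by positivity) (le_norm_waveVec_sq j.2) _ ht.1 ht.2.le

lemma tendsto_integral_exp_neg_sq_mul_sq (ξ : ℝ) (hξ : 0 < ξ) :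
    Tendsto (fun r : ℝ => ∫ t in (0 : ℝ)..ξ, Real.exp (-(t ^ 2 * r ^ 2))) atTop (𝓝 0) := by
  have hπ := Real.sqrt_pos.2 Real.pi_pos
  have h1 : Tendsto (fun r : ℝ => √Real.pi / 2 * (erf (ξ * r) * r⁻¹)) atTop (𝓝 0) := by
    have := ((tendsto_erf_atTop.comp (tendsto_id.const_mul_atTop hξ)).mul
      tendsto_inv_atTop_zero).const_mul (√Real.pi / 2)
    simpa using this
  refine h1.congr' ?_
  filter_upwards [eventually_gt_atTop 0] with r hr
  rw [← div_eq_mul_inv, ← integral_exp_neg_sq_mul_sq ξ hr.ne', ← mul_assoc,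
    (by field_simp : √Real.pi / 2 * (2 / √Real.pi) = 1), one_mul]

lemma tendsto_mul_erfc (hξ : 0 < ξ) :
    Tendsto (fun s : ℝ => s * erfc (ξ * s)) atTop (𝓝 0) := by
  have h1 : Tendsto (fun s : ℝ => (ξ ^ 2)⁻¹ * s⁻¹) atTop (𝓝 0) := by
    simpa using tendsto_inv_atTop_zero.const_mul (ξ ^ 2)⁻¹
  refine tendsto_of_tendsto_of_tendsto_of_le_of_le' tendsto_const_nhds h1 ?_ ?_
  · filter_upwards [eventually_ge_atTop 0] with s hs using mul_nonneg hs (erfc_nonneg _)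
  · filter_upwards [eventually_gt_atTop 0] with s hs
    have h2 := mul_exp_neg_le_one ((ξ * s) ^ 2)
    have h3 := erfc_le_exp_neg_sq (x := ξ * s) (by positivity)
    calc s * erfc (ξ * s) ≤ s * Real.exp (-(ξ * s) ^ 2) := by gcongr
      _ = (ξ ^ 2)⁻¹ * s⁻¹ * ((ξ * s) ^ 2 * Real.exp (-(ξ * s) ^ 2)) := by field_simp
      _ ≤ (ξ ^ 2)⁻¹ * s⁻¹ * 1 := by gcongr
      _ = _ := mul_one _

lemma tendsto_zeroMode_sub (hξ : 0 < ξ) :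
    Tendsto (fun s : ℝ => zeroMode ξ s - √Real.pi * s) atTop (𝓝 0) := by
  have h1 : Tendsto (fun s : ℝ => Real.exp (-(ξ ^ 2 * s ^ 2)) / ξ) atTop (𝓝 0) := by
    have := (tendsto_exp_neg_sq_atTop.comp (tendsto_id.const_mul_atTop hξ)).div_const ξ
    simpa [mul_pow] using this
  have h2 := h1.sub ((tendsto_mul_erfc hξ).const_mul √Real.pi)
  simp only [mul_zero, sub_zero] at h2
  refine h2.congr fun s => ?_
  rw [zeroMode, erfc_eq_one_sub_erf]; ring

lemma zeroMode_neg (ξ s : ℝ) : zeroMode ξ (-s) = zeroMode ξ s := by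
  simp only [zeroMode, mul_neg, erf_neg, neg_mul, neg_neg, neg_sq]

lemma tendsto_sum_zeroMode (hξ : 0 < ξ) (hq : ∑ n, q n = 0) (a : Fin N → ℝ) :
    Tendsto (fun s : ℝ => ∑ n, q n * zeroMode ξ (s - a n)) atTop
      (𝓝 (-(√Real.pi * ∑ n, q n * a n))) := by
  have h1 : ∀ n, Tendsto (fun s : ℝ => q n * (zeroMode ξ (s - a n) - √Real.pi * (s - a n))) atTop
      (𝓝 (q n * 0)) := fun n =>
    ((tendsto_zeroMode_sub hξ).comp (tendsto_atTop_add_const_right _ (-a n) tendsto_id)).const_mul _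
  have h2 := (tendsto_finsetSum Finset.univ fun n _ => h1 n).add_const (-(√Real.pi * ∑ n, q n * a n))
  simp only [mul_zero, Finset.sum_const_zero, zero_add] at h2
  refine h2.congr fun s => ?_
  have h3 : ∑ n, q n * (√Real.pi * (s - a n)) = -(√Real.pi * ∑ n, q n * a n) := by
    have : ∀ n, q n * (√Real.pi * (s - a n)) = √Real.pi * s * q n - √Real.pi * (q n * a n) :=
      fun n => by ring
    simp only [this, Finset.sum_sub_distrib, ← Finset.mul_sum, hq, mul_zero, zero_sub]
  simp only [mul_sub (q _) (zeroMode _ _), Finset.sum_sub_distrib, h3]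
  ring

lemma tsum_erfc_le (hL : 0 < L) (hξ : 0 < ξ) {v : Space} (hv : 1 ≤ |v 2|) :
    |∑' p, erfc (ξ * ‖v + shift L p‖) / ‖v + shift L p‖|
      ≤ Real.pi / L ^ 2 * (Real.exp (-(ξ ^ 2 * |v 2| ^ 2)) / ξ ^ 2)
      * ∑' j : ℤ × ℤ, Real.exp (-(1 / (4 * ξ ^ 2) * ‖waveVec L j‖ ^ 2)) := by
  rw [sq_abs]
  refine le_trans ?_ (gaussSum_le hL hξ le_rfl v)
  rw [← Real.norm_eq_abs]
  refine tsum_of_norm_bounded (summable_exp_neg_norm_add_shift hL (pow_pos hξ 2) v).hasSum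
    fun p => ?_
  have h1 : 1 ≤ ‖v + shift L p‖ := by
    have h2 := norm_add_shift_sq L v p
    have h3 : (1 : ℝ) ≤ v 2 ^ 2 := by rw [← sq_abs]; exact one_le_pow₀ hv
    refine (one_le_sq_iff₀ (norm_nonneg _)).1 ?_
    rw [h2]; nlinarith [sq_nonneg (v 0 + L * p.1), sq_nonneg (v 1 + L * p.2)]
  rw [Real.norm_eq_abs, abs_of_nonneg (div_nonneg (erfc_nonneg _) (norm_nonneg _))]
  refine (div_le_self (erfc_nonneg _) h1).trans ((erfc_le_exp_neg_sq (by positivity)).trans ?_)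
  rw [mul_pow]

/-- Off the mode zero everything decays in the free direction. -/
lemma tendsto_pot (hL : 0 < L) (hξ : 0 < ξ) (hq : ∑ n, q n = 0) {l : Filter Space} {c : ℝ}
    (hl : Tendsto (fun y : Space => |y 2|) l atTop)
    (hz : Tendsto (fun y : Space => ∑ n, q n * zeroMode ξ (y 2 - x n 2)) l (𝓝 c)) :
    Tendsto (pot L q x) l (𝓝 (-(2 * √Real.pi / L ^ 2 * c))) := by
  have hln : ∀ n, Tendsto (fun y : Space => |(y - x n) 2|) l atTop := by
    intro n
    refine tendsto_atTop_mono (fun y => ?_) (tendsto_atTop_add_const_right _ (-|x n 2|) hl)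
    have := abs_sub_abs_le_abs_sub (y 2) (x n 2)
    rw [PiLp.sub_apply]; linarith
  have h1 : Tendsto (fun y : Space => ∑ n, q n
      * ∑' p, erfc (ξ * ‖y - x n + shift L p‖) / ‖y - x n + shift L p‖) l (𝓝 0) := by
    have : ∀ n, Tendsto (fun y : Space => q n
        * ∑' p, erfc (ξ * ‖y - x n + shift L p‖) / ‖y - x n + shift L p‖) l (𝓝 (q n * 0)) := by
      intro n
      refine Tendsto.const_mul _ ?_
      have h2 : Tendsto (fun s : ℝ => Real.pi / L ^ 2 * (Real.exp (-(ξ ^ 2 * s ^ 2)) / ξ ^ 2)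
          * ∑' j : ℤ × ℤ, Real.exp (-(1 / (4 * ξ ^ 2) * ‖waveVec L j‖ ^ 2))) atTop (𝓝 0) := by
        have := (((tendsto_exp_neg_sq_atTop.comp (tendsto_id.const_mul_atTop hξ)).div_const
          (ξ ^ 2)).const_mul (Real.pi / L ^ 2)).mul_const
          (∑' j : ℤ × ℤ, Real.exp (-(1 / (4 * ξ ^ 2) * ‖waveVec L j‖ ^ 2)))
        simpa only [Function.comp_def, id, mul_pow, zero_div, mul_zero, zero_mul] using this
      refine squeeze_zero_norm' ?_ (h2.comp (hln n))
      filter_upwards [(hln n).eventually_ge_atTop 1] with y hy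
      exact tsum_erfc_le hL hξ hy
    simpa using tendsto_finsetSum Finset.univ fun n _ => this n
  have h2 : Tendsto (fun y : Space => ∑ n, (q n : ℂ) * waveSum L ξ (y - x n)) l (𝓝 0) := by
    have : ∀ n, Tendsto (fun y : Space => (q n : ℂ) * waveSum L ξ (y - x n)) l (𝓝 (q n * 0)) := by
      intro n
      refine Tendsto.const_mul _ (squeeze_zero_norm (fun y => norm_waveSum_le hL hξ _) ?_)
      have := ((tendsto_integral_exp_neg_sq_mul_sq ξ hξ).comp (hln n)).const_mul
        (∑' j : {j : ℤ × ℤ // j ≠ 0}, 8 / (2 * Real.pi / L) ^ 2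
          * Real.exp (-(1 / (8 * ξ ^ 2) * ‖waveVec L j‖ ^ 2)))
      simpa only [Function.comp_def, sq_abs, mul_zero] using this
    simpa using tendsto_finsetSum Finset.univ fun n _ => this n
  have h3 : Tendsto (fun y : Space => 2 / √Real.pi
      * ∫ t in (0 : ℝ)..ξ, ∑ n, q n * gaussSum L t (y - x n)) l
      (𝓝 (-(2 * √Real.pi / L ^ 2 * c))) := by
    have h4 := (h2.sub ((Complex.continuous_ofReal.tendsto c).comp hz)).const_mul
      ((2 * √Real.pi / L ^ 2 : ℝ) : ℂ)
    have h5 := (Complex.continuous_re.tendsto _).comp h4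
    refine (h5.congr fun y => ?_).trans (le_of_eq ?_)
    · rw [Function.comp_apply, ← Complex.ofReal_re (2 / √Real.pi * _),
        integral_gaussSum hL hξ hq fun n => y - x n]
      rfl
    · congr 1
      rw [zero_sub, mul_neg, ← Complex.ofReal_mul, ← Complex.ofReal_neg, Complex.ofReal_re]
  have h6 := h1.add h3
  rw [zero_add] at h6
  refine h6.congr' ?_
  filter_upwards [eventually_all.2 fun n => (hln n).eventually_gt_atTop 0] with y hy
  -- far away in the free direction there are no charges
  have h7 : ∀ n (p : ℤ × ℤ), y - x n + shift L p ≠ 0 := by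
    intro n p h
    have := congrArg (fun v : Space => v 2) h
    have h8 := abs_pos.1 (hy n)
    simp [shift] at this h8
    exact h8 this
  rw [pot_eq x hL hξ hq]
  simp [h7]

/-- The symmetric Coulomb sum solves the planar-periodic Poisson problem. -/
theorem isPotential_pot (hL : 0 < L) (hq : ∑ n, q n = 0) : IsPotential L q x (pot L q x) where
  periodic := pot_periodic x hL hq
  locallyIntegrable := locallyIntegrable_pot x hL hq
  continuousOn := continuousOn_pot x hL hq
  poisson ψ hψ hc := pot_poisson x hL hq (by exact_mod_cast contDiff_infty.1 hψ 2) hc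
  tendsto_top := by
    have h := tendsto_pot x hL one_pos hq (l := comap (fun y : Space => y 2) atTop)
      (tendsto_abs_atTop_atTop.comp tendsto_comap)
      ((tendsto_sum_zeroMode one_pos hq fun n => x n 2).comp tendsto_comap)
    convert h using 2
    rw [mul_neg, neg_neg, ← mul_assoc]
    congr 1
    have := Real.mul_self_sqrt Real.pi_pos.le
    rw [div_mul_eq_mul_div, mul_assoc 2, this]
  tendsto_bot := by
    have h := tendsto_pot x hL one_pos hq (l := comap (fun y : Space => y 2) atBot)
      (c := √Real.pi * ∑ n, q n * x n 2)
      (tendsto_abs_atBot_atTop.comp tendsto_comap) ?_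
    · convert h using 3
      rw [← mul_assoc]
      congr 1
      have := Real.mul_self_sqrt Real.pi_pos.le
      rw [div_mul_eq_mul_div, mul_assoc 2, this]
    · have h := (tendsto_sum_zeroMode one_pos hq fun n => -x n 2).comp
        (tendsto_neg_atBot_atTop.comp (tendsto_comap (f := fun y : Space => y 2)))
      convert h using 1
      · ext y
        refine Finset.sum_congr rfl fun n _ => ?_
        rw [← zeroMode_neg]
        simp only [Function.comp_apply]
        congr 2; ring
      · simp

end pot

/-! ### Uniqueness -/

lemma hasDerivAt_comp_line {f : Space → ℝ} (hf : Differentiable ℝ f) (y e : Space) (s : ℝ) :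
    HasDerivAt (fun s : ℝ => f (y + s • e)) (fderiv ℝ f (y + s • e) e) s := by
  have h1 : HasDerivAt (fun s : ℝ => y + s • e) e s := by
    simpa using ((hasDerivAt_id s).smul_const e).const_add y
  exact (hf _).hasFDerivAt.comp_hasDerivAt s h1

/-- The necessary second-order condition, from the one-dimensional sufficient one. -/
lemma secondDeriv_nonpos_of_isLocalMax {f : Space → ℝ} (hf : ContDiff ℝ 2 f) {y : Space}
    (hy : IsLocalMax f y) (i : Fin 3) : secondDeriv i f y ≤ 0 := by
  set e : Space := EuclideanSpace.single i 1
  set g : ℝ → ℝ := fun s => f (y + s • e) with hg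
  have hf1 : Differentiable ℝ f := hf.differentiable two_ne_zero
  have hd1 : deriv g = fun s => fderiv ℝ f (y + s • e) e :=
    funext fun s => (hasDerivAt_comp_line hf1 y e s).deriv
  have hd2 : deriv (deriv g) 0 = secondDeriv i f y := by
    rw [hd1]
    have := (hasDerivAt_comp_line ((contDiff_fderiv_apply (m := 1) hf (by norm_num)
      e).differentiable one_ne_zero) y e 0).deriv
    rw [this, zero_smul, add_zero]
    rfl
  have hmax : IsLocalMax g 0 := by
    have hc : ContinuousAt (fun s : ℝ => y + s • e) 0 := by fun_prop
    have h2 : Tendsto (fun s : ℝ => y + s • e) (𝓝 0) (𝓝 y) := by simpa using hc.tendsto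
    filter_upwards [h2.eventually hy] with s hs
    simpa [hg] using hs
  by_contra! hpos
  rw [← hd2] at hpos
  have hmin := isLocalMin_of_deriv_deriv_pos hpos hmax.deriv_eq_zero
    (hasDerivAt_comp_line hf1 y e 0).continuousAt
  -- a point that is both a local maximum and a local minimum forces `g` to be locally constant
  have hconst : g =ᶠ[𝓝 0] fun _ => g 0 := by
    filter_upwards [hmin, hmax] with s h1 h2 using le_antisymm h2 h1
  have h3 : deriv (deriv g) 0 = 0 := by
    rw [hconst.deriv.deriv_eq]; simp
  linarith

/-- Every point can be translated into the cell around the origin. -/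
lemma exists_add_shift_mem_cell {L : ℝ} (hL : 0 < L) (y : Space) :
    ∃ p : ℤ × ℤ, ‖(y + shift L p) 0‖ ≤ L ∧ ‖(y + shift L p) 1‖ ≤ L ∧ (y + shift L p) 2 = y 2 := by
  have key : ∀ a : ℝ, ‖a + L * ((-⌊a / L⌋ : ℤ) : ℝ)‖ ≤ L := by
    intro a
    have h1 := Int.floor_le (a / L)
    have h2 := (Int.lt_floor_add_one (a / L)).le
    rw [le_div_iff₀ hL] at h1
    rw [div_le_iff₀ hL] at h2
    push_cast
    rw [Real.norm_eq_abs, abs_le]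
    constructor <;> nlinarith
  refine ⟨(-⌊y 0 / L⌋, -⌊y 1 / L⌋), ?_, ?_, ?_⟩
  · simpa [shift] using key (y 0)
  · simpa [shift] using key (y 1)
  · simp [shift]

/-- The maximum principle: a smooth harmonic function that is periodic in the plane and vanishes at
infinity in the free direction is nonpositive. A small multiple of `z²` is added to make the
function strictly subharmonic. -/
lemma nonpos_of_harmonic {L : ℝ} (hL : 0 < L) {u : Space → ℝ} (hu : ContDiff ℝ 2 u)
    (hharm : ∀ y, ∑ i, secondDeriv i u y = 0) (hper : ∀ (p : ℤ × ℤ) y, u (y + shift L p) = u y)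
    (hlim : ∀ ε > 0, ∃ Z, ∀ y : Space, Z ≤ |y 2| → |u y| ≤ ε) (y₀ : Space) : u y₀ ≤ 0 := by
  by_contra! hM
  set M := u y₀ with hMdef
  obtain ⟨Z₀, hZ₀⟩ := hlim (M / 2) (half_pos hM)
  set Z := max Z₀ 1 with hZdef
  have hZ1 : 1 ≤ Z := le_max_right _ _
  have hZ : ∀ y : Space, Z ≤ |y 2| → u y ≤ M / 2 := fun y hy =>
    (le_abs_self _).trans (hZ₀ y ((le_max_left _ _).trans hy))
  -- `δ z²` is at most `M / 4` on the slab, so that the boundary values stay below `3 M / 4`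
  set δ := M / (4 * Z ^ 2) with hδ
  have hδpos : 0 < δ := by positivity
  set w : Space → ℝ := fun y => u y + δ * y 2 ^ 2 with hw
  have hcoord : ∀ i : Fin 3, Continuous fun y : Space => y i := fun i => by fun_prop
  have hwc : Continuous w := hu.continuous.add (by fun_prop)
  have hwper : ∀ (p : ℤ × ℤ) y, w (y + shift L p) = w y := by
    intro p y
    have : (y + shift L p) 2 = y 2 := by simp [shift]
    simp only [hw, hper, this]
  set K : Set Space := {y | ‖y 0‖ ≤ L ∧ ‖y 1‖ ≤ L ∧ ‖y 2‖ ≤ Z} with hK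
  have hKc : IsCompact K := by
    refine Metric.isCompact_of_isClosed_isBounded ?_ ?_
    · exact (isClosed_le (hcoord 0).norm continuous_const).inter
        ((isClosed_le (hcoord 1).norm continuous_const).inter
          (isClosed_le (hcoord 2).norm continuous_const))
    · refine (Metric.isBounded_closedBall (x := (0 : Space)) (r := L + L + Z)).subset fun y hy => ?_
      obtain ⟨h0, h1, h2⟩ := hy
      rw [mem_closedBall_zero_iff]
      refine le_of_sq_le_sq ?_ (by positivity)
      rw [EuclideanSpace.norm_sq_eq, Fin.sum_univ_three]
      nlinarith [norm_nonneg (y 0), norm_nonneg (y 1), norm_nonneg (y 2)]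
  have hy₀Z : |y₀ 2| ≤ Z := by
    by_contra! h
    have := hZ y₀ h.le
    linarith
  have hKne : K.Nonempty := by
    obtain ⟨p, h0, h1, h2⟩ := exists_add_shift_mem_cell hL y₀
    exact ⟨_, h0, h1, by rw [h2]; exact hy₀Z⟩
  obtain ⟨ym, hymK, hmax⟩ := hKc.exists_isMaxOn hKne hwc.continuousOn
  -- by periodicity the maximum over one cell is the maximum over the slab
  have hmax' : ∀ y : Space, |y 2| ≤ Z → w y ≤ w ym := by
    intro y hy
    obtain ⟨p, h0, h1, h2⟩ := exists_add_shift_mem_cell hL y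
    rw [← hwper p y]
    exact hmax ⟨h0, h1, by rw [h2]; exact hy⟩
  have hMw : M ≤ w ym := by
    refine le_trans ?_ (hmax' y₀ hy₀Z)
    have : 0 ≤ δ * y₀ 2 ^ 2 := by positivity
    simp only [hw]; linarith
  have hlt : |ym 2| < Z := by
    refine lt_of_le_of_ne hymK.2.2 fun h => ?_
    have h1 := hZ ym h.ge
    have h2 : δ * ym 2 ^ 2 = M / 4 := by
      rw [← sq_abs, h, hδ]; field_simp
    have : w ym = u ym + δ * ym 2 ^ 2 := rfl
    linarith
  have hloc : IsLocalMax w ym := by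
    have : ∀ᶠ y : Space in 𝓝 ym, |y 2| < Z :=
      ((hcoord 2).abs.tendsto ym).eventually (gt_mem_nhds hlt)
    filter_upwards [this] with y hy using hmax' y hy.le
  have hw2 : ContDiff ℝ 2 w := hu.add (contDiff_const.mul
    ((EuclideanSpace.proj (2 : Fin 3) : Space →L[ℝ] ℝ).contDiff.pow 2))
  have hsec : ∀ i, secondDeriv i w ym = secondDeriv i u ym + if i = 2 then 2 * δ else 0 := by
    intro i
    have hproj : ∀ z : Space, HasFDerivAt (fun y : Space => y 2)
        (EuclideanSpace.proj (2 : Fin 3) : Space →L[ℝ] ℝ) z := fun z =>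
      (EuclideanSpace.proj (2 : Fin 3) : Space →L[ℝ] ℝ).hasFDerivAt
    have h1 : ∀ z : Space, fderiv ℝ w z (EuclideanSpace.single i 1)
        = fderiv ℝ u z (EuclideanSpace.single i 1) + (if i = 2 then 2 * δ else 0) * z 2 := by
      intro z
      have hq : HasFDerivAt w _ z := (hu.differentiable two_ne_zero z).hasFDerivAt.add
        (((hproj z).pow 2).const_mul δ)
      rw [hq.fderiv]
      by_cases hi : i = 2
      · subst hi; simp; ring
      · have : (2 : Fin 3) ≠ i := Ne.symm hi
        simp [hi, this]
    have h2 : HasFDerivAt (fun z => fderiv ℝ u z (EuclideanSpace.single i 1)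
        + (if i = 2 then 2 * δ else 0) * z 2) _ ym :=
      ((contDiff_fderiv_apply (m := 1) hu (by norm_num) (EuclideanSpace.single i
        1)).differentiable one_ne_zero ym).hasFDerivAt.add ((hproj ym).const_mul _)
    rw [secondDeriv, funext h1, h2.fderiv, secondDeriv]
    by_cases hi : i = 2
    · subst hi; simp
    · simp [hi]
  have hsum : ∑ i, secondDeriv i w ym = 2 * δ := by
    simp only [hsec, Finset.sum_add_distrib, hharm]
    simp
  have : ∑ i, secondDeriv i w ym ≤ 0 :=
    Finset.sum_nonpos fun i _ => secondDeriv_nonpos_of_isLocalMax hw2 hloc i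
  linarith

open scoped Convolution in
lemma fderiv_convolution_apply {η h : Space → ℝ} (hη : ContDiff ℝ 1 η) (hc : HasCompactSupport η)
    (hh : LocallyIntegrable h volume) (v y : Space) :
    fderiv ℝ (η ⋆[ContinuousLinearMap.lsmul ℝ ℝ, volume] h : Space → ℝ) y v
      = ((fun z => fderiv ℝ η z v) ⋆[ContinuousLinearMap.lsmul ℝ ℝ, volume] h : Space → ℝ) y := by
  rw [(hc.hasFDerivAt_convolution_left (ContinuousLinearMap.lsmul ℝ ℝ) hη hh y).fderiv]
  have hex := (hc.fderiv ℝ).convolutionExists_left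
    ((ContinuousLinearMap.lsmul ℝ ℝ : ℝ →L[ℝ] ℝ →L[ℝ] ℝ).precompL Space)
    (hη.continuous_fderiv one_ne_zero) hh y
  simp only [convolution_def]
  rw [ContinuousLinearMap.integral_apply hex]
  rfl

open scoped Convolution in
lemma secondDeriv_convolution {η h : Space → ℝ} (hη : ContDiff ℝ 2 η) (hc : HasCompactSupport η)
    (hh : LocallyIntegrable h volume) (i : Fin 3) (y : Space) :
    secondDeriv i (η ⋆[ContinuousLinearMap.lsmul ℝ ℝ, volume] h : Space → ℝ) y
      = (secondDeriv i η ⋆[ContinuousLinearMap.lsmul ℝ ℝ, volume] h : Space → ℝ) y := by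
  have h1 := fun z => fderiv_convolution_apply (hη.of_le one_le_two) hc hh
    (EuclideanSpace.single i 1) z
  rw [secondDeriv, funext h1, fderiv_convolution_apply
    (contDiff_fderiv_apply (m := 1) hη (by norm_num) _) (hc.fderiv_apply ℝ _) hh]
  rfl

lemma fderiv_comp_const_sub_apply {f : Space → ℝ} (hf : Differentiable ℝ f) (y z v : Space) :
    fderiv ℝ (fun w => f (y - w)) z v = -fderiv ℝ f (y - z) v := by
  have h1 : HasFDerivAt (fun w : Space => y - w) (-ContinuousLinearMap.id ℝ Space) z :=
    (hasFDerivAt_id z).const_sub y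
  have h2 : HasFDerivAt (fun w => f (y - w)) _ z := (hf (y - z)).hasFDerivAt.comp z h1
  rw [h2.fderiv]
  simp

lemma secondDeriv_comp_const_sub {f : Space → ℝ} (hf : ContDiff ℝ 2 f) (i : Fin 3) (y z : Space) :
    secondDeriv i (fun w => f (y - w)) z = secondDeriv i f (y - z) := by
  have hf1 := (contDiff_fderiv_apply (m := 1) hf (by norm_num)
    (EuclideanSpace.single i (1 : ℝ))).differentiable one_ne_zero
  rw [secondDeriv, funext fun z => fderiv_comp_const_sub_apply (hf.differentiable two_ne_zero) y z _,
    fderiv_fun_neg, neg_apply, fderiv_comp_const_sub_apply hf1, neg_neg]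
  rfl

open scoped Convolution in
/-- Mollification turns a weakly harmonic function into a harmonic one. -/
lemma sum_secondDeriv_convolution_eq_zero {η h : Space → ℝ} (hη : ContDiff ℝ ∞ η)
    (hc : HasCompactSupport η) (hh : LocallyIntegrable h volume)
    (hweak : ∀ ψ : Space → ℝ, ContDiff ℝ ∞ ψ → HasCompactSupport ψ → ∫ y, h y * (-(Δ ψ y)) = 0)
    (y : Space) :
    ∑ i, secondDeriv i (η ⋆[ContinuousLinearMap.lsmul ℝ ℝ, volume] h : Space → ℝ) y = 0 := by
  have hη2 : ContDiff ℝ 2 η := by exact_mod_cast contDiff_infty.1 hη 2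
  have h1 : ContDiff ℝ ∞ fun w => η (y - w) := hη.comp (contDiff_const.sub contDiff_id)
  have h2 : HasCompactSupport fun w => η (y - w) :=
    hc.comp_homeomorph (Homeomorph.subLeft y)
  have h3 := hweak _ h1 h2
  simp only [mul_neg, integral_neg, neg_eq_zero] at h3
  have h4 : ∀ i, Integrable fun w => secondDeriv i η (y - w) * h w := fun i => by
    have := integrable_mul_of_hasCompactSupport hh
      ((continuous_secondDeriv hη2 i).comp (continuous_const.sub continuous_id) :
        Continuous fun w => secondDeriv i η (y - w))
      ((hasCompactSupport_secondDeriv hc i).comp_homeomorph (Homeomorph.subLeft y))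
    exact this.congr (Eventually.of_forall fun w => mul_comm _ _)
  simp only [secondDeriv_convolution hη2 hc hh, convolution_lsmul_swap, smul_eq_mul]
  rw [← integral_finsetSum _ fun i _ => h4 i, ← h3]
  congr 1; ext w
  rw [laplacian_eq_sum_secondDeriv (by exact_mod_cast contDiff_infty.1 h1 2), Finset.mul_sum]
  refine Finset.sum_congr rfl fun i _ => ?_
  rw [secondDeriv_comp_const_sub hη2, mul_comm]

/-- The charges are isolated. -/
lemma eventually_notMem_sites {N : ℕ} {L : ℝ} (hL : 0 < L) (x : Fin N → Space) (y₀ : Space) :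
    ∀ᶠ y in 𝓝[≠] y₀, y ∉ sites L x := by
  obtain ⟨R, hR⟩ := exists_norm_sub_le x (‖y₀‖ + 1)
  set T : Set (ℤ × ℤ) := {p | ¬ R + 1 ≤ ‖shift L p‖}
  have hT : T.Finite := eventually_cofinite.1 (eventually_le_norm_shift hL (R + 1))
  set F : Set Space := (fun a : Fin N × (ℤ × ℤ) => x a.1 - shift L a.2) '' (Set.univ ×ˢ T)
  have hF : F.Finite := (Set.finite_univ.prod hT).image _
  have h1 : ∀ᶠ y in 𝓝[≠] y₀, y ∉ F \ {y₀} :=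
    nhdsWithin_le_nhds ((hF.subset Set.sdiff_subset).isClosed.isOpen_compl.mem_nhds (by simp))
  have h2 : ∀ᶠ y in 𝓝[≠] y₀, y ∈ Metric.ball (0 : Space) (‖y₀‖ + 1) :=
    nhdsWithin_le_nhds (Metric.isOpen_ball.mem_nhds (by simp))
  filter_upwards [h1, h2, self_mem_nhdsWithin] with y hy1 hy2 hy3 hy4
  obtain ⟨n, p, rfl⟩ := hy4
  refine hy1 ⟨⟨(n, p), ⟨Set.mem_univ _, fun h => ?_⟩, rfl⟩, hy3⟩
  have := hR _ (by simpa using (Metric.mem_ball.1 hy2).le) n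
  rw [sub_sub_cancel_left, norm_neg] at this
  linarith

lemma IsPotential.integrable_mul_neg_laplacian {N : ℕ} {L : ℝ} {q : Fin N → ℝ} {x : Fin N → Space}
    {φ ψ : Space → ℝ} (hφ : IsPotential L q x φ) (hψ : ContDiff ℝ ∞ ψ) (hc : HasCompactSupport ψ) :
    Integrable fun y => φ y * (-(Δ ψ y)) := by
  have hψ2 : ContDiff ℝ 2 ψ := by exact_mod_cast contDiff_infty.1 hψ 2
  exact integrable_mul_of_hasCompactSupport hφ.locallyIntegrable
    (continuous_laplacian hψ2).neg (hasCompactSupport_laplacian hψ2 hc).neg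

open scoped Convolution in
/-- Two solutions of the Poisson problem agree off the charges: a mollification of the difference is
harmonic, periodic and small at infinity, hence zero. -/
theorem IsPotential.eqOn {N : ℕ} {L : ℝ} (hL : 0 < L) {q : Fin N → ℝ} {x : Fin N → Space}
    {φ₁ φ₂ : Space → ℝ} (h₁ : IsPotential L q x φ₁) (h₂ : IsPotential L q x φ₂) :
    Set.EqOn φ₁ φ₂ (sites L x)ᶜ := by
  set h : Space → ℝ := fun y => φ₁ y - φ₂ y with hh
  have hloc : LocallyIntegrable h volume := h₁.locallyIntegrable.sub h₂.locallyIntegrable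
  have hper : ∀ (p : ℤ × ℤ) y, h (y + shift L p) = h y := fun p y => by
    simp only [hh, h₁.periodic, h₂.periodic]
  have hweak : ∀ ψ : Space → ℝ, ContDiff ℝ ∞ ψ → HasCompactSupport ψ →
      ∫ y, h y * (-(Δ ψ y)) = 0 := by
    intro ψ hψ hc
    simp only [hh, sub_mul]
    rw [integral_sub (h₁.integrable_mul_neg_laplacian hψ hc)
      (h₂.integrable_mul_neg_laplacian hψ hc), h₁.poisson ψ hψ hc, h₂.poisson ψ hψ hc, sub_self]
  have hlim : ∀ ε > 0, ∃ Z : ℝ, ∀ y : Space, Z ≤ |y 2| → |h y| ≤ ε := by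
    intro ε hε
    have ht := (h₁.tendsto_top.sub h₂.tendsto_top).abs
    have hb := (h₁.tendsto_bot.sub h₂.tendsto_bot).abs
    rw [sub_self, abs_zero] at ht hb
    obtain ⟨s, hs, hsub⟩ := mem_comap.1 (ht.eventually (gt_mem_nhds hε))
    obtain ⟨s', hs', hsub'⟩ := mem_comap.1 (hb.eventually (gt_mem_nhds hε))
    obtain ⟨a, ha⟩ := mem_atTop_sets.1 hs
    obtain ⟨b, hb'⟩ := mem_atBot_sets.1 hs'
    refine ⟨max a (-b), fun y hy => ?_⟩
    rcases le_total 0 (y 2) with h0 | h0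
    · rw [abs_of_nonneg h0] at hy
      exact le_of_lt (hsub (ha _ ((le_max_left _ _).trans hy)))
    · rw [abs_of_nonpos h0] at hy
      have := (le_max_right a (-b)).trans hy
      exact le_of_lt (hsub' (hb' _ (by linarith)))
  intro y₀ hy₀
  set b : ℕ → ContDiffBump (0 : Space) := fun n =>
    ⟨1 / (n + 2), 1 / (n + 1), by positivity,
      one_div_lt_one_div_of_lt (by positivity) (by linarith)⟩ with hb
  have hzero : ∀ n, ((b n).normed volume ⋆[ContinuousLinearMap.lsmul ℝ ℝ, volume] h :
      Space → ℝ) y₀ = 0 := by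
    intro n
    set η := (b n).normed (volume : Measure Space) with hη
    have hηs : ContDiff ℝ ∞ η := (b n).contDiff_normed
    have hηc : HasCompactSupport η := (b n).hasCompactSupport_normed
    have hr : (b n).rOut ≤ 1 := by
      simp only [hb]
      rw [div_le_one (by positivity)]
      have : (0 : ℝ) ≤ n := n.cast_nonneg
      linarith
    set u : Space → ℝ := (η ⋆[ContinuousLinearMap.lsmul ℝ ℝ, volume] h : Space → ℝ) with hu
    have husm : ContDiff ℝ 2 u := by
      have : ContDiff ℝ ((2 : ℕ∞) : WithTop ℕ∞) u := hηc.contDiff_convolution_left _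
        (by exact_mod_cast contDiff_infty.1 hηs 2) hloc
      exact_mod_cast this
    have huh := sum_secondDeriv_convolution_eq_zero hηs hηc hloc hweak
    have hup : ∀ (p : ℤ × ℤ) y, u (y + shift L p) = u y := by
      intro p y
      simp only [hu, convolution_def, add_sub_right_comm, hper]
    have hul : ∀ ε > 0, ∃ Z, ∀ y : Space, Z ≤ |y 2| → |u y| ≤ ε := by
      intro ε hε
      obtain ⟨Z, hZ⟩ := hlim ε hε
      refine ⟨Z + 1, fun y hy => ?_⟩
      have := dist_convolution_le (μ := (volume : Measure Space)) (f := η) (g := h) (x₀ := y)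
        (z₀ := 0) (R := (b n).rOut) hε.le (b n).support_normed_eq.subset
        (fun z => (b n).nonneg_normed z) (b n).integral_normed hloc.aestronglyMeasurable
        fun z hz => ?_
      · simpa [Real.dist_eq] using this
      · rw [Real.dist_eq, sub_zero]
        refine hZ z ?_
        have h1 : |z 2 - y 2| ≤ ‖z - y‖ := by
          simpa using PiLp.norm_apply_le (z - y) 2
        have h2 : ‖z - y‖ < (b n).rOut := by rwa [← dist_eq_norm]
        have h3 := abs_sub_abs_le_abs_sub (y 2) (z 2)
        rw [abs_sub_comm] at h3
        linarith
    refine le_antisymm (nonpos_of_harmonic hL husm huh hup hul y₀) ?_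
    have hneg : ∀ i y, secondDeriv i (fun z => -u z) y = -secondDeriv i u y := by
      intro i y
      simp only [secondDeriv, fderiv_fun_neg, neg_apply]
    have := nonpos_of_harmonic hL husm.neg (fun y => by
      simp only [hneg, Finset.sum_neg_distrib]
      rw [huh, neg_zero]) (fun p y => by simp [hup]) (fun ε hε => by simpa using hul ε hε) y₀
    simpa using this
  have hcont : ContinuousAt h y₀ := by
    have hnhds : (sites L x)ᶜ ∈ 𝓝 y₀ := by
      rw [← nhdsNE_sup_pure]
      exact ⟨eventually_notMem_sites hL x y₀, hy₀⟩
    exact (h₁.continuousOn.continuousAt hnhds).sub (h₂.continuousOn.continuousAt hnhds)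
  have hlimit := ContDiffBump.convolution_tendsto_right (μ := (volume : Measure Space)) (φ := b)
    (g := fun _ => h) (k := fun _ => y₀) (x₀ := y₀) (z₀ := h y₀) (l := atTop)
    tendsto_one_div_add_atTop_nhds_zero_nat
    (Eventually.of_forall fun _ => hloc.aestronglyMeasurable)
    (hcont.tendsto.comp tendsto_snd) tendsto_const_nhds
  simp only [hzero] at hlimit
  exact sub_eq_zero.1 (tendsto_nhds_unique hlimit tendsto_const_nhds)

/-! ### The Ewald sum -/

/-- The excluded term is zero anyway, by the convention for division by zero. -/
lemma realTerm_eq {N : ℕ} (L ξ : ℝ) (q : Fin N → ℝ) (x : Fin N → Space) (m n : Fin N)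
    (p : ℤ × ℤ) : realTerm L ξ q x m n p
      = q n * (erfc (ξ * ‖x m - x n + shift L p‖) / ‖x m - x n + shift L p‖) := by
  rw [realTerm]
  split_ifs with h
  · obtain ⟨rfl, rfl⟩ := h
    simp [shift_zero]
  · rfl

lemma coulombCell_eq {N : ℕ} (L : ℝ) (q : Fin N → ℝ) (x : Fin N → Space) (m : Fin N)
    (p : ℤ × ℤ) : coulombCell L q x m p = ∑ n, q n / ‖x m - x n + shift L p‖ := by
  refine Finset.sum_congr rfl fun n _ => ?_
  split_ifs with h
  · obtain ⟨rfl, rfl⟩ := h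
    simp [shift_zero]
  · rfl

lemma summable_realTerm {N : ℕ} {L ξ : ℝ} (hL : 0 < L) (hξ : 0 < ξ) (q : Fin N → ℝ)
    (x : Fin N → Space) (m n : Fin N) : Summable (realTerm L ξ q x m n) := by
  rw [funext (realTerm_eq L ξ q x m n)]
  exact (summable_erfc hL hξ _).mul_left _

lemma summable_closedTerm {N : ℕ} {L ξ : ℝ} (hL : 0 < L) (hξ : 0 < ξ) (q : Fin N → ℝ)
    (x : Fin N → Space) (m n : Fin N) :
    Summable fun j : {j : ℤ × ℤ // j ≠ 0} => closedTerm ξ q x m n (waveVec L j) := by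
  rw [funext fun j : {j : ℤ × ℤ // j ≠ 0} => closedTerm_eq hL hξ q x m n j.2]
  exact (summable_planeWave_mul_widthIntegral hL hξ _).mul_left _

lemma closedPart_eq {N : ℕ} {L ξ : ℝ} (hL : 0 < L) (hξ : 0 < ξ) (q : Fin N → ℝ)
    (x : Fin N → Space) (m : Fin N) : closedPart L ξ q x m
      = (2 * √Real.pi / L ^ 2 : ℝ) * ∑ n, (q n : ℂ) * waveSum L ξ (x m - x n) := by
  have h : ∀ n, ∑' j : {j : ℤ × ℤ // j ≠ 0}, closedTerm ξ q x m n (waveVec L j)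
      = (2 / √Real.pi : ℝ) * ((q n : ℂ) * waveSum L ξ (x m - x n)) := by
    intro n
    rw [funext fun j : {j : ℤ × ℤ // j ≠ 0} => closedTerm_eq hL hξ q x m n j.2, tsum_mul_left,
      mul_assoc]
    rfl
  simp only [closedPart, h]
  rw [← Finset.mul_sum, ← mul_assoc]
  congr 1
  have := Real.mul_self_sqrt Real.pi_pos.le
  have hs := (Real.sqrt_pos.2 Real.pi_pos).ne'
  have h2 : Real.pi / L ^ 2 * (2 / √Real.pi) = 2 * √Real.pi / L ^ 2 := by
    field_simp
    nlinarith
  exact_mod_cast h2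

lemma fourierPart_eq_closedPart {N : ℕ} {L ξ : ℝ} (hL : 0 < L) (hξ : 0 < ξ) (q : Fin N → ℝ)
    (x : Fin N → Space) (m : Fin N) : fourierPart L ξ q x m = closedPart L ξ q x m := by
  have h : ∀ n, ∑' j : {j : ℤ × ℤ // j ≠ 0}, ∫ κ : ℝ, fourierIntegrand ξ q x m n (waveVec L j) κ
      = (√Real.pi : ℝ) * ((q n : ℂ) * waveSum L ξ (x m - x n)) := by
    intro n
    rw [funext fun j : {j : ℤ × ℤ // j ≠ 0} => integral_fourierIntegrand hL hξ q x m n j.2,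
      tsum_mul_left, mul_assoc]
    rfl
  rw [closedPart_eq hL hξ]
  simp only [fourierPart, h]
  rw [← Finset.mul_sum, ← mul_assoc]
  congr 1
  push_cast
  ring

lemma sub_add_shift_eq_zero_iff {N : ℕ} {L : ℝ} (hL : 0 < L) {x : Fin N → Space}
    (hdistinct : ∀ m n : Fin N, m ≠ n → ∀ p : ℤ × ℤ, x m - x n + shift L p ≠ 0) (m n : Fin N)
    (p : ℤ × ℤ) : x m - x n + shift L p = 0 ↔ n = m ∧ p = 0 := by
  constructor
  · intro h
    have hmn : n = m := by
      by_contra hne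
      exact hdistinct m n (Ne.symm hne) p h
    subst hmn
    refine ⟨rfl, ?_⟩
    by_contra hp
    exact shift_ne_zero hL hp (by simpa using h)
  · rintro ⟨rfl, rfl⟩
    simp [shift_zero]

/-- The Ewald sum is the symmetric Coulomb sum at the position of a particle. -/
theorem ewald_eq_pot {N : ℕ} {L ξ : ℝ} (hL : 0 < L) (hξ : 0 < ξ) {q : Fin N → ℝ}
    {x : Fin N → Space} (hq : ∑ n, q n = 0)
    (hdistinct : ∀ m n : Fin N, m ≠ n → ∀ p : ℤ × ℤ, x m - x n + shift L p ≠ 0) (m : Fin N) :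
    (realPart L ξ q x m : ℂ) + closedPart L ξ q x m + (zeroModePart L ξ q x m : ℂ)
      + (selfPart ξ q m : ℂ) = (pot L q x (x m) : ℂ) := by
  have h1 : realPart L ξ q x m
      = ∑ n, q n * ∑' p, erfc (ξ * ‖x m - x n + shift L p‖) / ‖x m - x n + shift L p‖ := by
    simp only [realPart, realTerm_eq, tsum_mul_left]
  have h2 : ∑ n, q n * ∑' p : ℤ × ℤ, (if x m - x n + shift L p = 0 then 2 * ξ / √Real.pi else 0)
      = -selfPart ξ q m := by
    simp only [sub_add_shift_eq_zero_iff hL hdistinct]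
    have : ∀ n, ∑' p : ℤ × ℤ, (if n = m ∧ p = 0 then 2 * ξ / √Real.pi else 0)
        = if n = m then 2 * ξ / √Real.pi else 0 := by
      intro n
      by_cases hn : n = m
      · simp [hn]
      · simp [hn]
    simp [this, selfPart]
  have h3 : zeroModePart L ξ q x m
      = -(2 * √Real.pi / L ^ 2 * ∑ n, q n * zeroMode ξ ((x m - x n) 2)) := by
    simp only [zeroModePart, zeroMode, PiLp.sub_apply, neg_mul]
  have h4 := integral_gaussSum hL hξ hq fun n => x m - x n
  rw [pot_eq x hL hξ hq, h2, h1, closedPart_eq hL hξ, h3, Complex.ofReal_sub, Complex.ofReal_add, h4]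
  push_cast
  ring

/-- Over a symmetric finite set, the cells and their averages over `±p` have the same sum. -/
lemma tendsto_sum_coulombCell {N : ℕ} {L : ℝ} (hL : 0 < L) {q : Fin N → ℝ} (x : Fin N → Space)
    (hq : ∑ n, q n = 0) (m : Fin N) :
    Tendsto (fun F : Finset (ℤ × ℤ) => ∑ p ∈ F, coulombCell L q x m p) symmetricFinsets
      (𝓝 (pot L q x (x m))) := by
  have h1 : Tendsto (fun F : Finset (ℤ × ℤ) => ∑ p ∈ F, symCell L q (fun n => x m - x n) p)
      symmetricFinsets (𝓝 (pot L q x (x m))) :=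
    (hasSum_symCell hL one_pos hq _).summable.hasSum.mono_left inf_le_left
  refine h1.congr' ?_
  have hsymm : ∀ᶠ F in symmetricFinsets, ∀ p ∈ F, -p ∈ F :=
    mem_inf_of_right (mem_principal_self _)
  filter_upwards [hsymm] with F hF
  have h2 : ∑ p ∈ F, coulombCell L q x m (-p) = ∑ p ∈ F, coulombCell L q x m p :=
    Finset.sum_nbij' (fun p => -p) (fun p => -p) hF hF (fun p _ => neg_neg p)
      (fun p _ => neg_neg p) fun p _ => rfl
  have h3 : ∀ p, symCell L q (fun n => x m - x n) p
      = (coulombCell L q x m p + coulombCell L q x m (-p)) / 2 := by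
    intro p
    rw [coulombCell_eq, coulombCell_eq, ← Finset.sum_add_distrib, Finset.sum_div]
    refine Finset.sum_congr rfl fun n _ => ?_
    rw [shift_neg, ← sub_eq_add_neg]
    ring
  simp only [h3]
  rw [← Finset.sum_div, Finset.sum_add_distrib, h2]
  ring

end PlanarEwald

open PlanarEwald in
theorem mainTheorem1 {N : ℕ} (L ξ : ℝ) (hL : 0 < L) (hξ : 0 < ξ)
    (q : Fin N → ℝ) (x : Fin N → Space)
    (hneutral : ∑ n, q n = 0)
    (hdistinct : ∀ m n : Fin N, m ≠ n → ∀ p : ℤ × ℤ, x m - x n + shift L p ≠ 0) :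
    -- the Poisson problem has exactly one solution away from the charges
    (∃ φ, IsPotential L q x φ) ∧
    (∀ φ ψ, IsPotential L q x φ → IsPotential L q x ψ → Set.EqOn φ ψ (sites L x)ᶜ) ∧
    -- absolute convergence of all series and integrals of the Ewald sum
    (∀ m n, Summable (realTerm L ξ q x m n)) ∧
    (∀ m n, ∀ j : {j : ℤ × ℤ // j ≠ 0},
      Integrable (fourierIntegrand ξ q x m n (waveVec L j)) volume) ∧
    (∀ m n, Summable (fun j : {j : ℤ × ℤ // j ≠ 0} =>
      ∫ κ : ℝ, fourierIntegrand ξ q x m n (waveVec L j) κ)) ∧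
    (∀ m n, Summable (fun j : {j : ℤ × ℤ // j ≠ 0} => closedTerm ξ q x m n (waveVec L j))) ∧
    -- the two forms of the k-space part agree
    (∀ m, fourierPart L ξ q x m = closedPart L ξ q x m) ∧
    -- the potential at the `m`-th particle, without its self-interaction
    (∀ φ, IsPotential L q x φ → ∀ m,
      Tendsto (fun y : Space => ((φ y - q m / ‖y - x m‖ : ℝ) : ℂ)) (𝓝[≠] (x m))
        (𝓝 ((realPart L ξ q x m : ℂ) + closedPart L ξ q x m + (zeroModePart L ξ q x m : ℂ)
          + (selfPart ξ q m : ℂ)))) ∧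
    -- the direct Coulomb sum over the periodic images, summed cell by cell in symmetric order
    (∀ m,
      Tendsto (fun F : Finset (ℤ × ℤ) => ((∑ p ∈ F, coulombCell L q x m p : ℝ) : ℂ))
        symmetricFinsets
        (𝓝 ((realPart L ξ q x m : ℂ) + closedPart L ξ q x m + (zeroModePart L ξ q x m : ℂ)
          + (selfPart ξ q m : ℂ)))) := by
  refine ⟨⟨_, isPotential_pot x hL hneutral⟩, fun φ ψ hφ hψ => hφ.eqOn hL hψ,
    summable_realTerm hL hξ q x, fun m n j => integrable_fourierIntegrand hL hξ q x m n j.2,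
    fun m n => ?_, summable_closedTerm hL hξ q x, fourierPart_eq_closedPart hL hξ q x,
    fun φ hφ m => ?_, fun m => ?_⟩
  · rw [funext fun j : {j : ℤ × ℤ // j ≠ 0} => integral_fourierIntegrand hL hξ q x m n j.2]
    exact (summable_planeWave_mul_widthIntegral hL hξ _).mul_left _
  · rw [ewald_eq_pot hL hξ hneutral hdistinct]
    have h1 := (continuousAt_pot_sub x hL hneutral hdistinct m).tendsto
    simp only [sub_self, norm_zero, div_zero, sub_zero] at h1
    refine (Complex.continuous_ofReal.tendsto _).comp
      ((h1.mono_left nhdsWithin_le_nhds).congr' ?_)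
    filter_upwards [eventually_notMem_sites hL x (x m)] with y hy
    rw [hφ.eqOn hL (isPotential_pot x hL hneutral) hy]
  · rw [ewald_eq_pot hL hξ hneutral hdistinct]
    exact (Complex.continuous_ofReal.tendsto _).comp (tendsto_sum_coulombCell hL x hneutral m)
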